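/- **Conventions.** A *tree* is a set with a strict partial order $<$ in which the set of predecessors of each node is well-ordered; $x\parallel y$ means that $x,y$ are incomparable, a *branch* is an inclusion-maximal chain, a *son* of $x$ is an immediate successor of $x$, and $\mathrm{sons}(x)$ is the set of sons of $x$. For a tree $\mathcal T$, $\max\mathcal T$ is the set of maximal nodes, $0_{\mathcal T}$ is the least node (if it exists), and $A{\uparrow}_{\mathcal T}=\{x\in\mathcal T:\exists a\in A\ (a\le_{\mathcal T}x)\}$. A *foliage tree* $\mathbf F$ is a tree (its *skeleton*) together with a set $\mathbf F_x$ (the *leaf* at $x$) for each node $x$; notions defined for trees are applied to $\mathbf F$ through its skeleton. $\mathbf F$ is *nonincreasing* if $x\le y$ implies $\mathbf F_y\subseteq\mathbf F_x$. The *standard foliage tree* $\mathbf S$ has as its skeleton the set ${}^{<\omega}\omega$ of finite sequences ordered by proper extension, and its leaves are $\mathbf S_x=\{p\in{}^\omega\omega: x\subseteq p\}$. $\mathbf F$ is a *Baire foliage tree* on a space $X$ if its skeleton is isomorphic to $({}^{<\omega}\omega,\subset)$, all leaves are open subsets of $X$, $\mathbf F_{0_{\mathbf F}}=X$, the leaf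 at each non-maximal node is the union of the pairwise disjoint leaves at its sons, and for each branch $B$ the set $\bigcap_{x\in B}\mathbf F_x$ is a singleton. Let $\mathrm{shoot}_{\mathbf F}(z)=\{\bigcup_{s\in C}\mathbf F_s : C\text{ a cofinite subset of }\mathrm{sons}_{\mathbf F}(z)\}$. A foliage tree $\mathbf H$ *shoots into* $\mathbf F$ if for every $p\in\bigcup_x\mathbf H_x$ and every node $y$ of $\mathbf F$ with $p\in\mathbf F_y$ there is a node $x$ of $\mathbf H$ with $p\in\mathbf H_x$ such that each nonempty $D\in\mathrm{shoot}_{\mathbf F}(y)$ includes a nonempty $G\in\mathrm{shoot}_{\mathbf H}(x)$. A *graft* for a tree $\mathcal T$ is a tree $\mathcal G$ with more than one node and with a least node such that $0_{\mathcal G}\in\mathcal T$, $\max\mathcal G$ is an antichain in $\mathcal T$ all of whose elements are $>_{\mathcal T}0_{\mathcal G}$, and the *implant* $\mathrm{impl}\,\mathcal G=\mathcal G\setminus(\{0_{\mathcal G}\}\cup\max\mathcal G)$ is disjoint from $\mathcal T$. Its *explant* is $\mathrm{expl}(\mathcal T,\mathcal G)=\{x\in\mathcal T:x>_{\mathcal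 T}0_{\mathcal G}\}\setminus(\max\mathcal G){\uparrow}_{\mathcal T}$. A set $\gamma$ of grafts for $\mathcal T$ is *consistent* if distinct $\mathcal D,\mathcal E\in\gamma$ have disjoint implants and satisfy $0_{\mathcal D}\parallel_{\mathcal T}0_{\mathcal E}$ or $0_{\mathcal D}\in(\max\mathcal E){\uparrow}_{\mathcal T}$ or $0_{\mathcal E}\in(\max\mathcal D){\uparrow}_{\mathcal T}$. Put $\mathrm{supp}=\mathcal T\setminus\bigcup_{\mathcal G\in\gamma}\mathrm{expl}(\mathcal T,\mathcal G)$. The *hybrid* of $\mathcal T$ and a consistent $\gamma$ has the set of nodes $\mathrm{supp}\cup\bigcup_{\mathcal G\in\gamma}\mathrm{impl}\,\mathcal G$, and $x<y$ in it iff one of the following holds: 1. $x,y\in\mathrm{supp}$ and $x<_{\mathcal T}y$; 2. $x,y\in\mathrm{impl}\,\mathcal G$ and $x<_{\mathcal G}y$ for some $\mathcal G\in\gamma$; 3. $x\in\mathrm{supp}$, $y\in\mathrm{impl}\,\mathcal G$ and $x\le_{\mathcal T}0_{\mathcal G}$ for some $\mathcal G\in\gamma$; 4. $x\in\mathrm{impl}\,\mathcal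 G$, $y\in\mathrm{supp}$ and $x<_{\mathcal G}r\le_{\mathcal T}y$ for some $\mathcal G\in\gamma$ and $r\in\max\mathcal G$; 5. $x\in\mathrm{impl}\,\mathcal D$, $y\in\mathrm{impl}\,\mathcal E$ and $x<_{\mathcal D}r\le_{\mathcal T}0_{\mathcal E}$ for some distinct $\mathcal D,\mathcal E\in\gamma$ and $r\in\max\mathcal D$. A *foliage graft* for a nonincreasing foliage tree $\mathbf F$ is a nonincreasing foliage tree $\mathbf G$ whose skeleton is a graft for the skeleton of $\mathbf F$, with $\mathbf G_{0_{\mathbf G}}\subseteq\mathbf F_{0_{\mathbf G}}$ and $\mathbf G_m=\mathbf F_m$ for all $m\in\max\mathbf G$. A set $\varphi$ of foliage grafts for $\mathbf F$ is *consistent* if distinct members have distinct skeletons and the set of the skeletons is a consistent set of grafts for the skeleton of $\mathbf F$. Put $\mathrm{loss}=\bigcup_{\mathbf G\in\varphi}(\mathbf F_{0_{\mathbf G}}\setminus\mathbf G_{0_{\mathbf G}})$. The *foliage hybrid* of $\mathbf F$ and a consistent $\varphi$ is the foliage tree $\mathbf H$ whose skeleton is the hybrid of the skeleton of $\mathbf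 F$ and the set of skeletons of members of $\varphi$, with $\mathbf H_x=\mathbf G_x\setminus\mathrm{loss}$ if $x\in\mathrm{impl}\,\mathbf G$ for some $\mathbf G\in\varphi$, and $\mathbf H_x=\mathbf F_x\setminus\mathrm{loss}$ otherwise. A set $A\subseteq{}^\omega\omega$ is *$\pi$-dense* in the Baire space if for every $y\in{}^{<\omega}\omega$ there are infinitely many $n\in\omega$ with $\mathbf S_{y^\frown\langle n\rangle}\subseteq A$. **Theorem.** Let $Y=\bigcap_{n\in\omega}U_n$, where each $U_n$ is an open $\pi$-dense subset of the Baire space (${}^\omega\omega$ with the product topology). Then there is a Baire foliage tree $\mathbf H$ on the subspace $Y$ that shoots into $\mathbf S$; moreover, $\mathbf H$ can be taken to be the foliage hybrid of $\mathbf S$ and some countable consistent family of foliage grafts for $\mathbf S$. -/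

import Mathlib

open Set

/-- A set of nodes (drawn from an ambient type `N`) with a binary relation on it. -/
@[ext]
structure NodeOrder (N : Type*) where
  /-- the set of nodes -/
  nodes : Set N
  /-- the strict order on the nodes -/
  lt : N → N → Prop
  mem_of_lt : ∀ {x y : N}, lt x y → x ∈ nodes ∧ y ∈ nodes

namespace NodeOrder

variable {N : Type*}

/-- The reflexive closure of the strict order. -/
def le (T : NodeOrder N) (x y : N) : Prop := T.lt x y ∨ x = y

/-- `x` and `y` are incomparable. -/
def Incomp (T : NodeOrder N) (x y : N) : Prop := ¬ T.le x y ∧ ¬ T.lt y x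

/-- A set-theoretic tree: a strict partial order in which the set of predecessors of each node
is well-ordered. -/
structure IsTree (T : NodeOrder N) : Prop where
  irrefl : ∀ x, ¬ T.lt x x
  trans : ∀ x y z, T.lt x y → T.lt y z → T.lt x z
  wellOrder : ∀ x ∈ T.nodes, IsWellOrder {v : N // T.lt v x} (fun a b => T.lt a b)

/-- The sons (immediate successors) of `x`. -/
def sons (T : NodeOrder N) (x : N) : Set N := {s | T.lt x s ∧ ¬ ∃ v, T.lt x v ∧ T.lt v s}

/-- The set of maximal nodes. -/
def maxNodes (T : NodeOrder N) : Set N := {m | m ∈ T.nodes ∧ ∀ v, ¬ T.lt m v}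

/-- `z` is the least node. -/
def IsLeastNode (T : NodeOrder N) (z : N) : Prop := z ∈ T.nodes ∧ ∀ y ∈ T.nodes, T.le z y

/-- The set of all nodes that are greater than or equal to some node in `A`. -/
def upper (T : NodeOrder N) (A : Set N) : Set N := {x | x ∈ T.nodes ∧ ∃ a ∈ A, T.le a x}

/-- Pairwise incomparable sets of nodes. -/
def IsAntichain (T : NodeOrder N) (A : Set N) : Prop :=
  A ⊆ T.nodes ∧ ∀ v ∈ A, ∀ w ∈ A, v ≠ w → T.Incomp v w

/-- Pairwise comparable sets of nodes. -/
def IsChain (T : NodeOrder N) (C : Set N) : Prop :=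
  C ⊆ T.nodes ∧ ∀ v ∈ C, ∀ w ∈ C, T.le v w ∨ T.lt w v

/-- A branch is an inclusion-maximal chain. -/
def IsBranch (T : NodeOrder N) (B : Set N) : Prop :=
  T.IsChain B ∧ ∀ C, T.IsChain C → B ⊆ C → C = B

/-- `T` is isomorphic to the set of finite sequences of natural numbers ordered by proper
extension. -/
def IsOmegaTree (T : NodeOrder N) : Prop :=
  Nonempty ((fun s t : List ℕ => s <+: t ∧ s ≠ t) ≃r (fun a b : T.nodes => T.lt a b))

/-- The implant of `G`: the nodes that are neither least nor maximal. -/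
def implant (G : NodeOrder N) : Set N :=
  {x | x ∈ G.nodes ∧ ¬ G.IsLeastNode x ∧ x ∉ G.maxNodes}

/-- The explant of `T` and `G`: the nodes of `T` strictly above the least node of `G` that are not
above (or equal to) a maximal node of `G`. -/
def explant (T G : NodeOrder N) : Set N :=
  {x | (∃ z, G.IsLeastNode z ∧ T.lt z x) ∧ x ∉ T.upper G.maxNodes}

/-- `G` is a graft for the tree `T`. -/
structure IsGraft (T G : NodeOrder N) : Prop where
  isTree : G.IsTree
  nontrivial : G.nodes.Nontrivial
  exists_least : ∃ z, G.IsLeastNode z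
  least_mem : ∀ z, G.IsLeastNode z → z ∈ T.nodes
  max_subset : G.maxNodes ⊆ T.nodes
  least_lt_max : ∀ z, G.IsLeastNode z → ∀ m ∈ G.maxNodes, T.lt z m
  max_antichain : T.IsAntichain G.maxNodes
  implant_disjoint : Disjoint G.implant T.nodes

/-- `γ` is a consistent family of grafts for the tree `T`. -/
structure IsConsistent (T : NodeOrder N) (γ : Set (NodeOrder N)) : Prop where
  isGraft : ∀ G ∈ γ, T.IsGraft G
  implants_disjoint : ∀ D ∈ γ, ∀ E ∈ γ, D ≠ E → Disjoint D.implant E.implant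
  compatible : ∀ D ∈ γ, ∀ E ∈ γ, D ≠ E → ∀ d e, D.IsLeastNode d → E.IsLeastNode e →
    T.Incomp d e ∨ d ∈ T.upper E.maxNodes ∨ e ∈ T.upper D.maxNodes

/-- The support of `T` for `γ`. -/
def support (T : NodeOrder N) (γ : Set (NodeOrder N)) : Set N :=
  T.nodes \ ⋃ G ∈ γ, T.explant G

/-- The strict order of the hybrid. In the last two cases `r` is the unique maximal node of
the graft that lies below (or equals) the given node of `T`. -/
inductive HybridLt (T : NodeOrder N) (γ : Set (NodeOrder N)) : N → N → Prop
  | base {x y : N} (hx : x ∈ T.support γ) (hy : y ∈ T.support γ) (h : T.lt x y) :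
      HybridLt T γ x y
  | inside {x y : N} (G : NodeOrder N) (hG : G ∈ γ) (hx : x ∈ G.implant) (hy : y ∈ G.implant)
      (h : G.lt x y) : HybridLt T γ x y
  | enter {x y : N} (G : NodeOrder N) (hG : G ∈ γ) (hx : x ∈ T.support γ) (hy : y ∈ G.implant)
      (z : N) (hz : G.IsLeastNode z) (h : T.le x z) : HybridLt T γ x y
  | leave {x y : N} (G : NodeOrder N) (hG : G ∈ γ) (hx : x ∈ G.implant) (hy : y ∈ T.support γ)
      (r : N) (hr : r ∈ G.maxNodes) (hry : T.le r y) (h : G.lt x r) : HybridLt T γ x y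
  | across {x y : N} (D E : NodeOrder N) (hD : D ∈ γ) (hE : E ∈ γ) (hne : D ≠ E)
      (hx : x ∈ D.implant) (hy : y ∈ E.implant) (e : N) (he : E.IsLeastNode e)
      (r : N) (hr : r ∈ D.maxNodes) (hre : T.le r e) (h : D.lt x r) : HybridLt T γ x y

/-- The hybrid of the tree `T` and a consistent family `γ` of grafts for `T`. -/
def hybrid (T : NodeOrder N) (γ : Set (NodeOrder N)) : NodeOrder N where
  nodes := T.support γ ∪ ⋃ G ∈ γ, G.implant
  lt := T.HybridLt γ
  mem_of_lt := by
    have key : ∀ {G : NodeOrder N} {x : N}, G ∈ γ → x ∈ G.implant →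
        x ∈ T.support γ ∪ ⋃ G ∈ γ, G.implant :=
      fun hG hx => Or.inr (mem_biUnion hG hx)
    intro x y h
    cases h with
    | base hx hy h => exact ⟨Or.inl hx, Or.inl hy⟩
    | inside G hG hx hy h => exact ⟨key hG hx, key hG hy⟩
    | enter G hG hx hy z hz h => exact ⟨Or.inl hx, key hG hy⟩
    | leave G hG hx hy r hr hry h => exact ⟨key hG hx, Or.inl hy⟩
    | across D E hD hE hne hx hy e he r hr hre h => exact ⟨key hD hx, key hE hy⟩

end NodeOrder

/-- A skeleton together with a leaf (a subset of `X`) at each node; it is a foliage tree when the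
skeleton is a tree. Outside the set of nodes the leaf is set to `∅`, so that two foliages are equal
exactly when they have the same nodes, the same order and the same leaves at the nodes. -/
@[ext]
structure Foliage (N X : Type*) where
  /-- the underlying ordered set of nodes -/
  skeleton : NodeOrder N
  /-- the leaf at a node -/
  leaf : N → Set X
  leaf_eq_empty : ∀ x, x ∉ skeleton.nodes → leaf x = ∅

namespace Foliage

variable {N M X : Type*}

/-- The skeleton is a tree. -/
def IsFoliageTree (F : Foliage N X) : Prop := F.skeleton.IsTree

/-- The intersection of the leaves at the nodes in `A`. -/
def fruit (F : Foliage N X) (A : Set N) : Set X := ⋂ x ∈ A, F.leaf x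

/-- The union of the leaves at the nodes in `A`. -/
def fleshOf (F : Foliage N X) (A : Set N) : Set X := ⋃ x ∈ A, F.leaf x

/-- The union of all leaves. -/
def flesh (F : Foliage N X) : Set X := F.fleshOf F.skeleton.nodes

/-- The family of unions of leaves over cofinite sets of sons of `z`. -/
def shoot (F : Foliage N X) (z : N) : Set (Set X) :=
  {A | ∃ C ⊆ F.skeleton.sons z, (F.skeleton.sons z \ C).Finite ∧ A = F.fleshOf C}

/-- The set of nodes whose leaf contains `p`. -/
def scope (F : Foliage N X) (p : X) : Set N := {y | y ∈ F.skeleton.nodes ∧ p ∈ F.leaf y}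

/-- Leaves decrease along the order. -/
def Nonincreasing (F : Foliage N X) : Prop :=
  ∀ x ∈ F.skeleton.nodes, ∀ y ∈ F.skeleton.nodes, F.skeleton.le x y → F.leaf y ⊆ F.leaf x

/-- The leaf at each non-maximal node is the disjoint union of the leaves at its sons. -/
def LocallyStrict (F : Foliage N X) : Prop :=
  ∀ x ∈ F.skeleton.nodes \ F.skeleton.maxNodes,
    F.leaf x = F.fleshOf (F.skeleton.sons x) ∧ (F.skeleton.sons x).PairwiseDisjoint F.leaf

/-- There is a node, and the leaves along each branch intersect in exactly one point. -/
def HasStrictBranches (F : Foliage N X) : Prop :=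
  F.skeleton.nodes.Nonempty ∧ ∀ B, F.skeleton.IsBranch B → ∃ p, F.fruit B = {p}

/-- All leaves are open subsets of the subspace `Y` of `X`. -/
def IsOpenInSubspace [TopologicalSpace X] (F : Foliage N X) (Y : Set X) : Prop :=
  ∀ z ∈ F.skeleton.nodes, ∃ V : Set X, IsOpen V ∧ F.leaf z = V ∩ Y

/-- `F` is a Baire foliage tree on the subspace `Y` of `X`. -/
structure IsBaireFoliageTreeOn [TopologicalSpace X] (F : Foliage N X) (Y : Set X) : Prop where
  isFoliageTree : F.IsFoliageTree
  isOpen : F.IsOpenInSubspace Y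
  locallyStrict : F.LocallyStrict
  isOmegaTree : F.skeleton.IsOmegaTree
  strictBranches : F.HasStrictBranches
  root_leaf : ∃ r, F.skeleton.IsLeastNode r ∧ F.leaf r = Y

/-- The family `γ` π-refines the family `δ`. -/
def PiRefines (γ δ : Set (Set X)) : Prop :=
  ∀ D ∈ δ, D.Nonempty → ∃ G ∈ γ, G.Nonempty ∧ G ⊆ D

/-- The foliage tree `H` shoots into the foliage tree `F`. -/
def ShootsInto (H : Foliage M X) (F : Foliage N X) : Prop :=
  ∀ p ∈ H.flesh, ∀ y ∈ F.scope p, ∃ x ∈ H.scope p, PiRefines (H.shoot x) (F.shoot y)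

/-- `G` is a foliage graft for the (nonincreasing) foliage tree `F`. -/
structure IsFoliageGraft (F G : Foliage N X) : Prop where
  isFoliageTree : G.IsFoliageTree
  nonincreasing : G.Nonincreasing
  isGraft : F.skeleton.IsGraft G.skeleton
  root_leaf : ∀ z, G.skeleton.IsLeastNode z → G.leaf z ⊆ F.leaf z
  max_leaf : ∀ m ∈ G.skeleton.maxNodes, G.leaf m = F.leaf m

/-- The cut from `F` by `G`: the part of the leaf of `F` at the least node of `G` that is not in
the leaf of `G` at this node. -/
def cut (F G : Foliage N X) : Set X :=
  {p | ∃ z, G.skeleton.IsLeastNode z ∧ p ∈ F.leaf z \ G.leaf z}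

/-- `φ` is a consistent family of foliage grafts for the (nonincreasing) foliage tree `F`. -/
structure IsConsistent (F : Foliage N X) (φ : Set (Foliage N X)) : Prop where
  isFoliageGraft : ∀ G ∈ φ, F.IsFoliageGraft G
  skeleton_injOn : ∀ D ∈ φ, ∀ E ∈ φ, D ≠ E → D.skeleton ≠ E.skeleton
  skeletons : F.skeleton.IsConsistent (skeleton '' φ)

/-- The loss of `F` on `φ`. -/
def loss (F : Foliage N X) (φ : Set (Foliage N X)) : Set X := ⋃ G ∈ φ, F.cut G

/-- The foliage hybrid of `F` and a consistent family `φ` of foliage grafts for `F`. (The support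
and the implants are pairwise disjoint, so at each node exactly one of the two clauses applies,
and the first one applies with exactly one `G`.) -/
def hybrid (F : Foliage N X) (φ : Set (Foliage N X)) : Foliage N X where
  skeleton := F.skeleton.hybrid (skeleton '' φ)
  leaf x := {p | (∃ G ∈ φ, x ∈ G.skeleton.implant ∧ p ∈ G.leaf x \ F.loss φ) ∨
    (x ∈ F.skeleton.support (skeleton '' φ) ∧ p ∈ F.leaf x \ F.loss φ)}
  leaf_eq_empty := by
    intro x hx
    refine eq_empty_of_forall_notMem ?_
    rintro p (⟨G, hG, hxG, -⟩ | ⟨hxs, -⟩)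
    · exact hx (Or.inr (mem_biUnion (mem_image_of_mem _ hG) hxG))
    · exact hx (Or.inl hxs)

end Foliage

/-- The basic open set of all infinite sequences that extend the finite sequence `x`. -/
def baseSet (x : List ℕ) : Set (ℕ → ℕ) := {p | ∀ (i : ℕ) (h : i < x.length), p i = x[i]}

/-- `A` is π-dense in the Baire space. -/
def IsPiDense (A : Set (ℕ → ℕ)) : Prop :=
  ∀ y : List ℕ, {n : ℕ | baseSet (y ++ [n]) ⊆ A}.Infinite

/-- The tree of finite sequences of natural numbers ordered by proper extension. The ambient type
also contains the elements of `I`, which are not nodes of this tree and serve as a supply of new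
nodes. -/
def standardTree (I : Type*) : NodeOrder (List ℕ ⊕ I) where
  nodes := range Sum.inl
  lt a b := ∃ s t : List ℕ, a = Sum.inl s ∧ b = Sum.inl t ∧ s <+: t ∧ s ≠ t
  mem_of_lt := by
    rintro x y ⟨s, t, rfl, rfl, -⟩
    exact ⟨⟨s, rfl⟩, ⟨t, rfl⟩⟩

/-- The standard foliage tree of the set of infinite sequences of natural numbers. -/
def standardFoliageTree (I : Type*) : Foliage (List ℕ ⊕ I) (ℕ → ℕ) where
  skeleton := standardTree I
  leaf := Sum.elim baseSet (fun _ => ∅)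
  leaf_eq_empty := by
    rintro (s | i) hx
    · exact absurd ⟨s, rfl⟩ hx
    · rfl

/-! Fix a basic open set S_x and an index n. Let T consist of x and of all extensions y of x with
S_y not included in U_n. The sets S_{y^c} included in U_n, with y in T, partition the part of S_x
inside U_n into cells, and π-density gives every y in T infinitely many cells. Enumerate T as z_0,
z_1, ... and distribute the cells over packages so that package i receives infinitely many cells at
each y between x and z_i (`nonempty_packing`). The sons of S_x are the packages. A package is peeled
level by level, shortest y first: the sons of a node are the cells of the current level and one more
node for the remaining levels. Each cell is then split with U_{n+1}.

Shooting: almost all sons of the node that peels level y are sets S_{y^c} with distinct c. Given p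
in Y and y with p in S_y, follow the cells containing p until one extends y properly. Then y is a
level of the package containing p, and the node peeling that level still contains p
(`exists_shooting_position`).

Branches: a package has finitely many levels, so along every infinite sequence of sons the leaf is a
basic open set infinitely often, with ever longer x. Hence a branch determines exactly one point.
Points are lost only when S_x is replaced by its packages, and these are the points outside U_n, so
Y is what remains (`traced_leafAt`).

Hybrid: a position whose leaf is some S_x is identified with the standard node x, and all other
positions become new nodes. The positions from one such position to the next ones form a graft, and
the hybrid of all these grafts is the whole tree of positions (`hybrid_schemeSkeletons`). This half
uses only the axioms in `IsLeafScheme`. -/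

/-! ### Finite sequences and basic open sets. -/

/-- `s` is a proper initial segment of `t`. -/
def StrictPrefix (s t : List ℕ) : Prop := s <+: t ∧ s ≠ t

namespace StrictPrefix

variable {s t u : List ℕ}

theorem trans_prefix (h : StrictPrefix s t) (h' : t <+: u) : StrictPrefix s u :=
  ⟨h.1.trans h', by
    rintro rfl
    exact h.2 (h.1.eq_of_length_le h'.length_le)⟩

theorem prefix_trans (h : s <+: t) (h' : StrictPrefix t u) : StrictPrefix s u :=
  ⟨h.trans h'.1, by
    rintro rfl
    exact h'.2 (h'.1.eq_of_length_le h.length_le)⟩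

theorem trans (h : StrictPrefix s t) (h' : StrictPrefix t u) : StrictPrefix s u :=
  h.trans_prefix h'.1

theorem length_lt (h : StrictPrefix s t) : s.length < t.length :=
  lt_of_le_of_ne h.1.length_le fun e => h.2 (h.1.eq_of_length e)

theorem not_prefix (h : StrictPrefix s t) : ¬ t <+: s :=
  fun h' => absurd h.length_lt (not_lt.2 h'.length_le)

theorem append_singleton (s : List ℕ) (i : ℕ) : StrictPrefix s (s ++ [i]) :=
  ⟨List.prefix_append s [i], by simp⟩

theorem exists_append_singleton_prefix (h : StrictPrefix s t) : ∃ i, s ++ [i] <+: t := by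
  obtain ⟨⟨l, rfl⟩, hne⟩ := h
  cases l with
  | nil => simp at hne
  | cons i l => exact ⟨i, l, by simp⟩

end StrictPrefix

theorem strictPrefix_append_singleton_iff {s t : List ℕ} {i : ℕ} :
    StrictPrefix s (t ++ [i]) ↔ s <+: t := by
  refine ⟨fun h => ?_, fun h => .prefix_trans h (.append_singleton t i)⟩
  rcases List.prefix_concat_iff.1 (by simpa using h.1) with h' | h'
  · exact absurd (by simpa using h') h.2
  · exact h'

theorem prefix_total {s t u : List ℕ} (h : s <+: u) (h' : t <+: u) :
    StrictPrefix s t ∨ t <+: s := by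
  by_cases e : s = t
  · exact .inr (e ▸ List.prefix_rfl)
  · exact (List.prefix_or_prefix_of_prefix h h').imp (fun h => ⟨h, e⟩) id

/-- The initial segment of length `n` of an infinite sequence. -/
def initSeg (p : ℕ → ℕ) (n : ℕ) : List ℕ := (List.range n).map p

@[simp] theorem length_initSeg (p : ℕ → ℕ) (n : ℕ) : (initSeg p n).length = n := by
  simp [initSeg]

@[simp] theorem getElem_initSeg (p : ℕ → ℕ) (n i : ℕ) (h : i < (initSeg p n).length) :
    (initSeg p n)[i] = p i := by
  simp [initSeg]

theorem initSeg_succ (p : ℕ → ℕ) (n : ℕ) : initSeg p (n + 1) = initSeg p n ++ [p n] := by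
  simp [initSeg, List.range_succ]

theorem initSeg_prefix (p : ℕ → ℕ) {m n : ℕ} (h : m ≤ n) : initSeg p m <+: initSeg p n := by
  rw [List.prefix_iff_getElem]
  exact ⟨by simpa using h, by simp⟩

theorem mem_baseSet_iff {p : ℕ → ℕ} {x : List ℕ} : p ∈ baseSet x ↔ initSeg p x.length = x := by
  constructor
  · intro h
    refine List.ext_getElem (by simp) fun i _ h2 => ?_
    rw [getElem_initSeg]
    exact h i h2
  · intro h i hi
    have := getElem_initSeg p x.length i (by simpa using hi)
    rw [← this]
    congr 1

theorem mem_baseSet_initSeg (p : ℕ → ℕ) (n : ℕ) : p ∈ baseSet (initSeg p n) := by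
  simp [mem_baseSet_iff]

theorem baseSet_nil : baseSet [] = univ := by
  ext p
  simp [baseSet]

theorem baseSet_subset_iff {x y : List ℕ} : baseSet x ⊆ baseSet y ↔ y <+: x := by
  constructor
  · intro h
    -- This point follows `x` and past its end differs from `y` everywhere, so `y` cannot be longer
    -- than `x`.
    have hp : (fun i => x.getD i (y.getD i 0 + 1)) ∈ baseSet x := fun i hi => by simp [hi]
    have hy := h hp
    have hlen : y.length ≤ x.length := by
      by_contra! hlt
      have := hy x.length hlt
      simp [hlt] at this
    rw [List.prefix_iff_getElem]
    refine ⟨hlen, fun i hi => ?_⟩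
    rw [← hy i hi, hp i (hi.trans_le hlen)]
  · rw [List.prefix_iff_getElem]
    rintro ⟨hlen, h⟩ p hp i hi
    rw [hp i (hi.trans_le hlen), h i hi]

theorem baseSet_injective : Function.Injective baseSet := fun _ _ h =>
  (baseSet_subset_iff.1 h.ge).eq_of_length_le (baseSet_subset_iff.1 h.le).length_le

theorem prefix_total_of_mem_baseSet {p : ℕ → ℕ} {x y : List ℕ} (hx : p ∈ baseSet x)
    (hy : p ∈ baseSet y) : StrictPrefix x y ∨ y <+: x := by
  rw [mem_baseSet_iff] at hx hy
  rw [← hx, ← hy]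
  exact prefix_total (initSeg_prefix p (le_max_left _ _)) (initSeg_prefix p (le_max_right _ _))

theorem baseSet_nonempty (x : List ℕ) : (baseSet x).Nonempty :=
  ⟨fun i => x.getD i 0, fun i hi => by simp [hi]⟩

theorem isOpen_baseSet (x : List ℕ) : IsOpen (baseSet x) := by
  have : baseSet x = ⋂ i : Fin x.length, (fun p : ℕ → ℕ => p i) ⁻¹' {x[i]} := by
    ext p
    simp [baseSet, Fin.forall_iff]
  rw [this]
  exact isOpen_iInter_of_finite fun i => (isOpen_discrete _).preimage (continuous_apply _)

theorem mem_baseSet_append_singleton {p : ℕ → ℕ} {y : List ℕ} {c : ℕ} :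
    p ∈ baseSet (y ++ [c]) ↔ p ∈ baseSet y ∧ p y.length = c := by
  rw [mem_baseSet_iff, mem_baseSet_iff]
  simp [initSeg_succ]

theorem exists_baseSet_initSeg_subset {U : Set (ℕ → ℕ)} (hU : IsOpen U) {p : ℕ → ℕ} (hp : p ∈ U) :
    ∃ n, baseSet (initSeg p n) ⊆ U := by
  obtain ⟨I, u, hu, hsub⟩ := isOpen_pi_iff.1 hU p hp
  refine ⟨I.sup id + 1, fun q hq => hsub fun i hi => ?_⟩
  have hlt : i < I.sup id + 1 := Nat.lt_succ_of_le (Finset.le_sup (f := id) hi)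
  have := hq i (by simpa using hlt)
  rw [getElem_initSeg] at this
  rw [this]
  exact (hu i hi).2

/-! ### Leaf schemes. -/

/-- The positions at which the leaf is a basic open set. -/
def conePositions (L : List ℕ → Set (ℕ → ℕ)) : Set (List ℕ) := {t | ∃ x, L t = baseSet x}

/-- A family of open sets, indexed by finite sequences, from which grafts for the standard foliage
tree can be read off: the leaves decrease, leaves at different sons are disjoint, only a leaf that
is a basic open set may lose points when passing to the sons, and along each infinite sequence the
leaf is infinitely often a basic open set. -/
structure IsLeafScheme (L : List ℕ → Set (ℕ → ℕ)) : Prop where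
  nil : L [] = baseSet []
  nonempty : ∀ t, (L t).Nonempty
  isOpen : ∀ t, IsOpen (L t)
  son_subset : ∀ t i, L (t ++ [i]) ⊆ L t
  sons_disjoint : ∀ t i j p, p ∈ L (t ++ [i]) → p ∈ L (t ++ [j]) → i = j
  cover : ∀ t, t ∉ conePositions L → ∀ p ∈ L t, ∃ i, p ∈ L (t ++ [i])
  frequently_cone : ∀ (a : ℕ → ℕ) N, ∃ n ≥ N, initSeg a n ∈ conePositions L

namespace IsLeafScheme

variable {L : List ℕ → Set (ℕ → ℕ)} {s t u : List ℕ}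

theorem nil_mem (hL : IsLeafScheme L) : [] ∈ conePositions L := ⟨[], hL.nil⟩

theorem anti (hL : IsLeafScheme L) (h : s <+: t) : L t ⊆ L s := by
  obtain ⟨l, rfl⟩ := h
  induction l using List.reverseRecOn with
  | nil => simp
  | append_singleton l i ih =>
    rw [← List.append_assoc]
    exact (hL.son_subset _ i).trans ih

theorem mem_son_unique (hL : IsLeafScheme L) {p : ℕ → ℕ} {i : ℕ} (hs : p ∈ L (t ++ [i]))
    (hu : p ∈ L u) (h : StrictPrefix t u) : t ++ [i] <+: u := by
  obtain ⟨j, hj⟩ := h.exists_append_singleton_prefix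
  rwa [hL.sons_disjoint t i j p hs (hL.anti hj hu)]

theorem total (hL : IsLeafScheme L) {p : ℕ → ℕ} (hs : p ∈ L s) (ht : p ∈ L t) :
    StrictPrefix s t ∨ t <+: s := by
  induction s using List.reverseRecOn with
  | nil =>
    by_cases h : [] = t
    · exact .inr (h ▸ List.prefix_rfl)
    · exact .inl ⟨List.nil_prefix, h⟩
  | append_singleton s i ih =>
    rcases ih (hL.son_subset _ _ hs) with h | h
    · have := hL.mem_son_unique hs ht h
      exact prefix_total this List.prefix_rfl
    · exact .inr (h.trans (List.prefix_append _ _))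

theorem subset_iff (hL : IsLeafScheme L) : L t ⊆ L s ↔ s <+: t := by
  refine ⟨fun h => ?_, hL.anti⟩
  obtain ⟨p, hp⟩ := hL.nonempty t
  rcases hL.total hp (h hp) with hts | hst
  · exfalso
    obtain ⟨i, hi⟩ := hts.exists_append_singleton_prefix
    -- Any son of `t` other than the `i`-th would do: its leaf is nonempty and disjoint from the
    -- leaf at `t ++ [i]`, which contains `L s`.
    obtain ⟨q, hq⟩ := hL.nonempty (t ++ [i + 1])
    have := hL.sons_disjoint t _ _ q hq (hL.anti hi (h (hL.son_subset _ _ hq)))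
    omega
  · exact hst

theorem injective (hL : IsLeafScheme L) : Function.Injective L := fun _ _ h =>
  (hL.subset_iff.1 h.ge).eq_of_length_le (hL.subset_iff.1 h.le).length_le

end IsLeafScheme

/-! ### Positions as nodes of the hybrid. -/

section Label

variable {L : List ℕ → Set (ℕ → ℕ)} {s t u : List ℕ}

open Classical in
/-- The node placed at a position: a node of the standard tree if the leaf is a basic open set, a
new node otherwise. -/
noncomputable def label (L : List ℕ → Set (ℕ → ℕ)) (t : List ℕ) : List ℕ ⊕ List ℕ :=
  if h : t ∈ conePositions L then Sum.inl h.choose else Sum.inr t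

theorem label_eq_inl {x : List ℕ} (h : L t = baseSet x) : label L t = Sum.inl x := by
  have ht : t ∈ conePositions L := ⟨x, h⟩
  rw [label, dif_pos ht]
  exact congrArg _ (baseSet_injective (ht.choose_spec.symm.trans h))

theorem label_eq_inr (h : t ∉ conePositions L) : label L t = Sum.inr t := dif_neg h

theorem label_injective (hL : IsLeafScheme L) : Function.Injective (label L) := by
  intro s t h
  by_cases hs : s ∈ conePositions L <;> by_cases ht : t ∈ conePositions L
  · obtain ⟨x, hx⟩ := hs
    obtain ⟨y, hy⟩ := ht
    rw [label_eq_inl hx, label_eq_inl hy, Sum.inl.injEq] at h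
    exact hL.injective (by rw [hx, hy, h])
  · obtain ⟨x, hx⟩ := hs
    simp [label_eq_inl hx, label_eq_inr ht] at h
  · obtain ⟨y, hy⟩ := ht
    simp [label_eq_inl hy, label_eq_inr hs] at h
  · simpa [label_eq_inr hs, label_eq_inr ht] using h

theorem standardTree_lt_inl {I : Type*} :
    (standardTree I).lt (Sum.inl s) (Sum.inl t) ↔ StrictPrefix s t := by
  constructor
  · rintro ⟨s', t', hs, ht, h⟩
    cases hs
    cases ht
    exact h
  · exact fun h => ⟨s, t, rfl, rfl, h⟩

theorem standardTree_le_inl {I : Type*} :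
    (standardTree I).le (Sum.inl s) (Sum.inl t) ↔ s <+: t := by
  rw [NodeOrder.le, standardTree_lt_inl, Sum.inl.injEq]
  constructor
  · rintro (h | rfl)
    exacts [h.1, List.prefix_rfl]
  · intro h
    by_cases e : s = t
    exacts [.inr e, .inl ⟨h, e⟩]

/-- Both orders are reverse inclusion of the same sets: of basic open sets in the standard tree, and
of leaves among positions by `IsLeafScheme.subset_iff`. -/
theorem standardTree_lt_label (hL : IsLeafScheme L) (hs : s ∈ conePositions L)
    (ht : t ∈ conePositions L) :
    (standardTree (List ℕ)).lt (label L s) (label L t) ↔ StrictPrefix s t := by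
  obtain ⟨x, hx⟩ := hs
  obtain ⟨y, hy⟩ := ht
  rw [label_eq_inl hx, label_eq_inl hy, standardTree_lt_inl, StrictPrefix, StrictPrefix,
    ← baseSet_subset_iff, ← hx, ← hy, hL.subset_iff, ← baseSet_injective.ne_iff, ← hx, ← hy,
    hL.injective.ne_iff]

theorem standardTree_le_label (hL : IsLeafScheme L) (hs : s ∈ conePositions L)
    (ht : t ∈ conePositions L) :
    (standardTree (List ℕ)).le (label L s) (label L t) ↔ s <+: t := by
  rw [NodeOrder.le, standardTree_lt_label hL hs ht, (label_injective hL).eq_iff]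
  constructor
  · rintro (h | rfl)
    exacts [h.1, List.prefix_rfl]
  · intro h
    by_cases e : s = t
    exacts [.inr e, .inl ⟨h, e⟩]

theorem label_mem_standardTree (h : t ∈ conePositions L) :
    label L t ∈ (standardTree (List ℕ)).nodes := by
  obtain ⟨x, hx⟩ := h
  exact ⟨x, (label_eq_inl hx).symm⟩

/-- The labels of a set of positions, ordered by proper extension of the positions. -/
def posOrder (L : List ℕ → Set (ℕ → ℕ)) (A : Set (List ℕ)) : NodeOrder (List ℕ ⊕ List ℕ) where
  nodes := label L '' A
  lt a b := ∃ s ∈ A, ∃ t ∈ A, a = label L s ∧ b = label L t ∧ StrictPrefix s t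
  mem_of_lt := by
    rintro _ _ ⟨s, hs, t, ht, rfl, rfl, -⟩
    exact ⟨⟨s, hs, rfl⟩, ⟨t, ht, rfl⟩⟩

variable {A : Set (List ℕ)}

theorem posOrder_lt_label (hL : IsLeafScheme L) :
    (posOrder L A).lt (label L s) (label L t) ↔ s ∈ A ∧ t ∈ A ∧ StrictPrefix s t := by
  constructor
  · rintro ⟨s', hs, t', ht, es, et, h⟩
    cases label_injective hL es
    cases label_injective hL et
    exact ⟨hs, ht, h⟩
  · rintro ⟨hs, ht, h⟩
    exact ⟨s, hs, t, ht, rfl, rfl, h⟩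

theorem posOrder_le_label (hL : IsLeafScheme L) (hs : s ∈ A) (ht : t ∈ A) :
    (posOrder L A).le (label L s) (label L t) ↔ s <+: t := by
  rw [NodeOrder.le, posOrder_lt_label hL, (label_injective hL).eq_iff]
  constructor
  · rintro (h | rfl)
    exacts [h.2.2.1, List.prefix_rfl]
  · intro h
    by_cases e : s = t
    exacts [.inr e, .inl ⟨hs, ht, h, e⟩]

theorem label_mem_posOrder (hL : IsLeafScheme L) : label L s ∈ (posOrder L A).nodes ↔ s ∈ A :=
  (label_injective hL).mem_set_image

theorem posOrder_isTree (hL : IsLeafScheme L) : (posOrder L A).IsTree where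
  irrefl := by
    rintro _ ⟨s, hs, t, ht, rfl, e, h⟩
    exact h.2 (label_injective hL e)
  trans := by
    rintro _ _ _ ⟨s, hs, t, ht, rfl, rfl, h⟩ ⟨t', -, u, hu, e, rfl, h'⟩
    cases label_injective hL e
    exact ⟨s, hs, u, hu, rfl, rfl, h.trans h'⟩
  wellOrder := by
    rintro _ ⟨t, ht, rfl⟩
    have key : ∀ v : {v // (posOrder L A).lt v (label L t)}, ∃ s ∈ A, s <+: t ∧ v = label L s := by
      rintro ⟨_, s, hs, t', -, rfl, e, h⟩
      cases label_injective hL e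
      exact ⟨s, hs, h.1, rfl⟩
    choose f hfA hft hf using key
    have hlt : ∀ v w : {v // (posOrder L A).lt v (label L t)},
        (posOrder L A).lt v w ↔ StrictPrefix (f v) (f w) := by
      intro v w
      rw [hf v, hf w, posOrder_lt_label hL]
      simp [hfA]
    have trich : ∀ v w : {v // (posOrder L A).lt v (label L t)},
        ¬ (posOrder L A).lt v w → ¬ (posOrder L A).lt w v → v = w := by
      intro v w h1 h2
      rw [hlt] at h1 h2
      have h3 := (prefix_total (hft v) (hft w)).resolve_left h1
      have h4 := (prefix_total (hft w) (hft v)).resolve_left h2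
      exact Subtype.ext (by rw [hf v, hf w, h4.eq_of_length_le h3.length_le])
    exact { trichotomous := trich
            wf := Subrelation.wf (fun {v w} h => ((hlt v w).1 h).length_lt)
              (measure fun v => (f v).length).wf }

theorem posOrder_univ_isLeastNode (hL : IsLeafScheme L) :
    (posOrder L univ).IsLeastNode (label L []) := by
  refine ⟨⟨_, trivial, rfl⟩, ?_⟩
  rintro _ ⟨t, -, rfl⟩
  exact (posOrder_le_label hL (mem_univ _) (mem_univ _)).2 List.nil_prefix

theorem posOrder_univ_sons (hL : IsLeafScheme L) :
    (posOrder L univ).sons (label L t) = range fun i => label L (t ++ [i]) := by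
  ext a
  constructor
  · rintro ⟨⟨_, -, s, -, e, rfl, h⟩, hmin⟩
    cases label_injective hL e
    obtain ⟨i, hi⟩ := h.exists_append_singleton_prefix
    refine ⟨i, congrArg _ ?_⟩
    by_contra hne
    exact hmin ⟨label L (t ++ [i]),
      (posOrder_lt_label hL).2 ⟨trivial, trivial, .append_singleton t i⟩,
      (posOrder_lt_label hL).2 ⟨trivial, trivial, hi, hne⟩⟩
  · rintro ⟨i, rfl⟩
    refine ⟨(posOrder_lt_label hL).2 ⟨trivial, trivial, .append_singleton t i⟩, ?_⟩
    rintro ⟨_, ⟨_, -, s, -, e, rfl, h⟩, h'⟩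
    cases label_injective hL e
    exact h.not_prefix (strictPrefix_append_singleton_iff.1 ((posOrder_lt_label hL).1 h').2.2)

theorem posOrder_univ_isOmegaTree (hL : IsLeafScheme L) : (posOrder L univ).IsOmegaTree := by
  have hbij : Function.Bijective
      (fun t => (⟨label L t, t, trivial, rfl⟩ : (posOrder L univ).nodes)) := by
    refine ⟨fun s t h => label_injective hL (congrArg Subtype.val h), ?_⟩
    rintro ⟨_, t, -, rfl⟩
    exact ⟨t, rfl⟩
  refine ⟨⟨Equiv.ofBijective _ hbij, ?_⟩⟩
  intro s t
  change (posOrder L univ).lt (label L s) (label L t) ↔ _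
  rw [posOrder_lt_label hL]
  simp [StrictPrefix]

end Label

/-! ### The grafts of a scheme and their consistency. -/

section Graft

variable {L : List ℕ → Set (ℕ → ℕ)} {s t u v : List ℕ}

/-- The positions extending `t` with no cone position strictly in between. -/
def graftPositions (L : List ℕ → Set (ℕ → ℕ)) (t : List ℕ) : Set (List ℕ) :=
  {s | t <+: s ∧ ∀ u, StrictPrefix t u → StrictPrefix u s → u ∉ conePositions L}

theorem self_mem_graftPositions : t ∈ graftPositions L t :=
  ⟨List.prefix_rfl, fun _ h h' => absurd h'.1 h.not_prefix⟩

theorem append_singleton_mem_graftPositions (hs : s ∈ graftPositions L t)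
    (h : s ∉ conePositions L ∨ s = t) (i : ℕ) : s ++ [i] ∈ graftPositions L t := by
  refine ⟨hs.1.trans (List.prefix_append _ _), fun u hu hu' huc => ?_⟩
  have hus := strictPrefix_append_singleton_iff.1 hu'
  by_cases e : u = s
  · subst e
    rcases h with h | rfl
    exacts [h huc, hu.2 rfl]
  · exact hs.2 u hu ⟨hus, e⟩ huc

theorem finite_setOf_prefix (s : List ℕ) : {u | u <+: s}.Finite :=
  (List.finite_toSet s.inits).subset fun u hu => by simpa using hu

/-- Take the longest cone position that is an initial segment of `s`. -/
theorem exists_mem_graftPositions (hL : IsLeafScheme L) (s : List ℕ) :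
    ∃ t ∈ conePositions L, s ∈ graftPositions L t := by
  obtain ⟨t, ⟨hts, htc⟩, hmax⟩ := Set.exists_max_image {u | u <+: s ∧ u ∈ conePositions L}
    List.length ((finite_setOf_prefix s).subset fun u hu => hu.1) ⟨[], List.nil_prefix, hL.nil_mem⟩
  exact ⟨t, htc, hts, fun u hu hu' huc => (hmax u ⟨hu'.1, huc⟩).not_gt hu.length_lt⟩

/-- The shortest cone position after `s` on the way to `u` has no cone position between it and `t`.
It is the maximal node through which the graft at `t` is left. -/
theorem exists_next_cone (hs : s ∈ graftPositions L t) (h : s ∉ conePositions L ∨ s = t)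
    (hu : u ∈ conePositions L) (hsu : StrictPrefix s u) :
    ∃ r ∈ conePositions L, StrictPrefix s r ∧ r <+: u ∧ r ∈ graftPositions L t := by
  obtain ⟨r, ⟨hru, hsr, hrc⟩, hmin⟩ := Set.exists_min_image
    {r | r <+: u ∧ StrictPrefix s r ∧ r ∈ conePositions L}
    List.length ((finite_setOf_prefix u).subset fun u hu => hu.1) ⟨u, List.prefix_rfl, hsu, hu⟩
  refine ⟨r, hrc, hsr, hru, hs.1.trans hsr.1, fun v hv hv' hvc => ?_⟩
  rcases prefix_total hsr.1 hv'.1 with hsv | hvs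
  · exact (hmin v ⟨hv'.1.trans hru, hsv, hvc⟩).not_gt hv'.length_lt
  · by_cases e : v = s
    · subst e
      rcases h with h | rfl
      exacts [h hvc, hv.2 rfl]
    · exact hs.2 v hv ⟨hvs, e⟩ hvc

theorem graftPositions_base_unique (ht : t ∈ conePositions L) (hu : u ∈ conePositions L)
    (hs : s ∉ conePositions L) (hst : s ∈ graftPositions L t) (hsu : s ∈ graftPositions L u) :
    t = u := by
  have hts : StrictPrefix t s := ⟨hst.1, by rintro rfl; exact hs ht⟩
  have hus : StrictPrefix u s := ⟨hsu.1, by rintro rfl; exact hs hu⟩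
  rcases prefix_total hst.1 hsu.1 with h | h
  · exact absurd hu (hst.2 u h hus)
  · by_contra e
    exact hsu.2 t ⟨h, Ne.symm e⟩ hts ht

/-- The foliage graft read off from the positions in `graftPositions L t`. -/
noncomputable def schemeGraft (L : List ℕ → Set (ℕ → ℕ)) (t : List ℕ) :
    Foliage (List ℕ ⊕ List ℕ) (ℕ → ℕ) where
  skeleton := posOrder L (graftPositions L t)
  -- The last condition matters only for `s = t`, where it removes the points that no son of `t`
  -- keeps; this is the cut. For a proper extension `s` of `t` it holds automatically.
  leaf a := {p | ∃ s ∈ graftPositions L t, a = label L s ∧ p ∈ L s ∧ ∃ i, p ∈ L (t ++ [i])}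
  leaf_eq_empty := by
    intro a ha
    refine eq_empty_of_forall_notMem ?_
    rintro p ⟨s, hs, rfl, -⟩
    exact ha ⟨s, hs, rfl⟩

theorem mem_schemeGraft_leaf (hL : IsLeafScheme L) {p : ℕ → ℕ} :
    p ∈ (schemeGraft L t).leaf (label L s) ↔
      s ∈ graftPositions L t ∧ p ∈ L s ∧ ∃ i, p ∈ L (t ++ [i]) := by
  constructor
  · rintro ⟨s', hs, e, h⟩
    cases label_injective hL e
    exact ⟨hs, h⟩
  · rintro ⟨hs, h⟩
    exact ⟨s, hs, rfl, h⟩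

theorem schemeGraft_leaf_of_strictPrefix (hL : IsLeafScheme L) (hs : s ∈ graftPositions L t)
    (h : StrictPrefix t s) : (schemeGraft L t).leaf (label L s) = L s := by
  ext p
  rw [mem_schemeGraft_leaf hL]
  refine ⟨fun h => h.2.1, fun hp => ⟨hs, hp, ?_⟩⟩
  obtain ⟨i, hi⟩ := h.exists_append_singleton_prefix
  exact ⟨i, hL.anti hi hp⟩

theorem schemeGraft_isLeastNode_iff (hL : IsLeafScheme L) {z : List ℕ ⊕ List ℕ} :
    (posOrder L (graftPositions L t)).IsLeastNode z ↔ z = label L t := by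
  constructor
  · rintro ⟨⟨s, hs, rfl⟩, h⟩
    have := (posOrder_le_label hL hs self_mem_graftPositions).1
      (h _ ⟨t, self_mem_graftPositions, rfl⟩)
    rw [this.eq_of_length_le hs.1.length_le]
  · rintro rfl
    refine ⟨⟨t, self_mem_graftPositions, rfl⟩, ?_⟩
    rintro _ ⟨s, hs, rfl⟩
    exact (posOrder_le_label hL self_mem_graftPositions hs).2 hs.1

theorem label_mem_schemeGraft_maxNodes (hL : IsLeafScheme L) :
    label L s ∈ (posOrder L (graftPositions L t)).maxNodes ↔
      s ∈ graftPositions L t ∧ s ∈ conePositions L ∧ StrictPrefix t s := by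
  constructor
  · rintro ⟨hs, h⟩
    rw [label_mem_posOrder hL] at hs
    have key : ¬ (s ∉ conePositions L ∨ s = t) := fun h' => h (label L (s ++ [0]))
      ((posOrder_lt_label hL).2
        ⟨hs, append_singleton_mem_graftPositions hs h' 0, .append_singleton s 0⟩)
    push Not at key
    exact ⟨hs, key.1, hs.1, key.2.symm⟩
  · rintro ⟨hs, hsc, hts⟩
    refine ⟨(label_mem_posOrder hL).2 hs, ?_⟩
    rintro _ ⟨s', -, u, hu, e, rfl, h⟩
    cases label_injective hL e
    exact hu.2 s hts h hsc

theorem mem_schemeGraft_maxNodes (hL : IsLeafScheme L) {m : List ℕ ⊕ List ℕ} :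
    m ∈ (posOrder L (graftPositions L t)).maxNodes ↔
      ∃ s ∈ graftPositions L t, s ∈ conePositions L ∧ StrictPrefix t s ∧ m = label L s := by
  constructor
  · intro h
    obtain ⟨s, -, rfl⟩ := h.1
    obtain ⟨h1, h2, h3⟩ := (label_mem_schemeGraft_maxNodes hL).1 h
    exact ⟨s, h1, h2, h3, rfl⟩
  · rintro ⟨s, h1, h2, h3, rfl⟩
    exact (label_mem_schemeGraft_maxNodes hL).2 ⟨h1, h2, h3⟩

theorem label_mem_schemeGraft_implant (hL : IsLeafScheme L) (ht : t ∈ conePositions L) :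
    label L s ∈ (posOrder L (graftPositions L t)).implant ↔
      s ∈ graftPositions L t ∧ s ∉ conePositions L := by
  rw [NodeOrder.implant, mem_ofPred_eq, label_mem_posOrder hL, schemeGraft_isLeastNode_iff hL,
    label_mem_schemeGraft_maxNodes hL, (label_injective hL).eq_iff]
  constructor
  · rintro ⟨hs, hne, h⟩
    exact ⟨hs, fun hc => h ⟨hs, hc, hs.1, Ne.symm hne⟩⟩
  · rintro ⟨hs, hc⟩
    exact ⟨hs, by rintro rfl; exact hc ht, fun h => hc h.2.1⟩

theorem mem_schemeGraft_implant (hL : IsLeafScheme L) (ht : t ∈ conePositions L)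
    {a : List ℕ ⊕ List ℕ} :
    a ∈ (posOrder L (graftPositions L t)).implant ↔
      ∃ s ∈ graftPositions L t, s ∉ conePositions L ∧ a = label L s := by
  constructor
  · intro h
    obtain ⟨s, -, rfl⟩ := h.1
    obtain ⟨h1, h2⟩ := (label_mem_schemeGraft_implant hL ht).1 h
    exact ⟨s, h1, h2, rfl⟩
  · rintro ⟨s, h1, h2, rfl⟩
    exact (label_mem_schemeGraft_implant hL ht).2 ⟨h1, h2⟩

theorem schemeGraft_isGraft (hL : IsLeafScheme L) (ht : t ∈ conePositions L) :
    (standardTree (List ℕ)).IsGraft (posOrder L (graftPositions L t)) where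
  isTree := posOrder_isTree hL
  nontrivial := ⟨label L t, ⟨t, self_mem_graftPositions, rfl⟩, label L (t ++ [0]),
    ⟨_, append_singleton_mem_graftPositions self_mem_graftPositions (.inr rfl) 0, rfl⟩,
    fun h => (StrictPrefix.append_singleton t 0).2 (label_injective hL h)⟩
  exists_least := ⟨label L t, (schemeGraft_isLeastNode_iff hL).2 rfl⟩
  least_mem := by
    intro z hz
    rw [(schemeGraft_isLeastNode_iff hL).1 hz]
    exact label_mem_standardTree ht
  max_subset := by
    intro m hm
    obtain ⟨s, -, hs, -, rfl⟩ := (mem_schemeGraft_maxNodes hL).1 hm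
    exact label_mem_standardTree hs
  least_lt_max := by
    intro z hz m hm
    obtain ⟨s, -, hs, hts, rfl⟩ := (mem_schemeGraft_maxNodes hL).1 hm
    rw [(schemeGraft_isLeastNode_iff hL).1 hz]
    exact (standardTree_lt_label hL ht hs).2 hts
  max_antichain := by
    constructor
    · intro m hm
      obtain ⟨s, -, hs, -, rfl⟩ := (mem_schemeGraft_maxNodes hL).1 hm
      exact label_mem_standardTree hs
    · intro m hm m' hm' hne
      obtain ⟨s, hs, hsc, hts, rfl⟩ := (mem_schemeGraft_maxNodes hL).1 hm
      obtain ⟨s', hs', hsc', hts', rfl⟩ := (mem_schemeGraft_maxNodes hL).1 hm'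
      rw [NodeOrder.Incomp, standardTree_le_label hL hsc hsc', standardTree_lt_label hL hsc' hsc]
      exact ⟨fun h => hs'.2 s hts ⟨h, fun e => hne (e ▸ rfl)⟩ hsc,
        fun h => hs.2 s' hts' h hsc'⟩
  implant_disjoint := by
    rw [Set.disjoint_left]
    rintro a ha ⟨x, rfl⟩
    obtain ⟨s, -, hs, h⟩ := (mem_schemeGraft_implant hL ht).1 ha
    simp [label_eq_inr hs] at h

/-- The skeletons of the grafts at all cone positions. -/
def schemeSkeletons (L : List ℕ → Set (ℕ → ℕ)) : Set (NodeOrder (List ℕ ⊕ List ℕ)) :=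
  (fun t => posOrder L (graftPositions L t)) '' conePositions L

theorem posOrder_graftPositions_injective (hL : IsLeafScheme L)
    (h : posOrder L (graftPositions L t) = posOrder L (graftPositions L u)) : t = u := by
  have := (schemeGraft_isLeastNode_iff hL (t := t)).2 rfl
  rw [h, schemeGraft_isLeastNode_iff hL] at this
  exact label_injective hL this

theorem label_mem_upper_maxNodes (hL : IsLeafScheme L) (hs : s ∈ conePositions L)
    (h : StrictPrefix t s) :
    label L s ∈ (standardTree (List ℕ)).upper (posOrder L (graftPositions L t)).maxNodes := by
  obtain ⟨r, hr, htr, hrs, hrt⟩ := exists_next_cone self_mem_graftPositions (.inr rfl) hs h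
  exact ⟨label_mem_standardTree hs, label L r,
    (label_mem_schemeGraft_maxNodes hL).2 ⟨hrt, hr, htr⟩, (standardTree_le_label hL hr hs).2 hrs⟩

theorem schemeSkeletons_isConsistent (hL : IsLeafScheme L) :
    (standardTree (List ℕ)).IsConsistent (schemeSkeletons L) where
  isGraft := by
    rintro _ ⟨t, ht, rfl⟩
    exact schemeGraft_isGraft hL ht
  implants_disjoint := by
    rintro _ ⟨t, ht, rfl⟩ _ ⟨u, hu, rfl⟩ hne
    rw [Set.disjoint_left]
    intro a hat hau
    obtain ⟨s, hst, hs, rfl⟩ := (mem_schemeGraft_implant hL ht).1 hat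
    have hsu := (label_mem_schemeGraft_implant hL hu).1 hau
    exact hne (by rw [graftPositions_base_unique ht hu hs hst hsu.1])
  compatible := by
    rintro _ ⟨t, ht, rfl⟩ _ ⟨u, hu, rfl⟩ hne d e hd he
    rw [(schemeGraft_isLeastNode_iff hL).1 hd, (schemeGraft_isLeastNode_iff hL).1 he]
    have htu : t ≠ u := by
      rintro rfl
      exact hne rfl
    by_cases h : t <+: u
    · exact .inr (.inr (label_mem_upper_maxNodes hL hu ⟨h, htu⟩))
    by_cases h' : u <+: t
    · exact .inr (.inl (label_mem_upper_maxNodes hL ht ⟨h', htu.symm⟩))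
    · rw [NodeOrder.Incomp, standardTree_le_label hL ht hu, standardTree_lt_label hL hu ht]
      exact .inl ⟨h, fun h'' => h' h''.1⟩

theorem mem_explant_iff (hL : IsLeafScheme L) {a : List ℕ ⊕ List ℕ} :
    a ∈ (standardTree (List ℕ)).explant (posOrder L (graftPositions L t)) ↔
      (standardTree (List ℕ)).lt (label L t) a ∧
        a ∉ (standardTree (List ℕ)).upper (posOrder L (graftPositions L t)).maxNodes := by
  simp [NodeOrder.explant, schemeGraft_isLeastNode_iff hL]

/-- For a node `w` in the support, take the longest cone position `t` whose leaf includes `baseSet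
w`. If `w` were not its label, `w` would lie strictly above the root of the graft at `t`, hence, not
being in the explant, above one of its maximal nodes, which is a longer such cone position. -/
theorem support_schemeSkeletons (hL : IsLeafScheme L) :
    (standardTree (List ℕ)).support (schemeSkeletons L) = label L '' conePositions L := by
  ext a
  constructor
  · rintro ⟨⟨w, rfl⟩, h⟩
    simp only [schemeSkeletons, mem_iUnion, exists_prop, not_exists, not_and,
      forall_mem_image, mem_explant_iff hL, not_not] at h
    have hfin : {t | t ∈ conePositions L ∧ baseSet w ⊆ L t}.Finite := by
      refine (((finite_setOf_prefix w).image Sum.inl).preimage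
        (label_injective hL).injOn).subset ?_
      rintro t ⟨⟨x, hx⟩, hsub⟩
      rw [hx, baseSet_subset_iff] at hsub
      exact ⟨x, hsub, (label_eq_inl hx).symm⟩
    obtain ⟨t, ⟨⟨x, hx⟩, hsub⟩, hmax⟩ := Set.exists_max_image _ List.length hfin
      ⟨[], hL.nil_mem, by simp [hL.nil, baseSet_nil]⟩
    have htc : t ∈ conePositions L := ⟨x, hx⟩
    rw [hx, baseSet_subset_iff] at hsub
    by_cases e : x = w
    · exact ⟨t, htc, by rw [label_eq_inl hx, e]⟩
    · exfalso
      obtain ⟨-, m, hm, hmw⟩ := h htc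
        (by rw [label_eq_inl hx]; exact standardTree_lt_inl.2 ⟨hsub, e⟩)
      obtain ⟨r, -, hr, htr, rfl⟩ := (mem_schemeGraft_maxNodes hL).1 hm
      obtain ⟨y, hy⟩ := id hr
      rw [label_eq_inl hy, standardTree_le_inl, ← baseSet_subset_iff, ← hy] at hmw
      exact (hmax r ⟨hr, hmw⟩).not_gt htr.length_lt
  · rintro ⟨s, hs, rfl⟩
    refine ⟨label_mem_standardTree hs, ?_⟩
    simp only [schemeSkeletons, mem_iUnion, exists_prop, not_exists, not_and,
      forall_mem_image, mem_explant_iff hL, not_not]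
    intro t ht h
    exact label_mem_upper_maxNodes hL hs ((standardTree_lt_label hL ht hs).1 h)

end Graft

/-! ### The hybrid is the tree of all positions. -/

section Hybrid

variable {L : List ℕ → Set (ℕ → ℕ)} {s t u v : List ℕ}

/-- The clause of the hybrid order depends on which of `s`, `t` are cone positions and, when neither
is, on whether they lie in the same graft. `exists_next_cone` supplies the maximal node that `leave`
and `across` ask for. -/
theorem hybridLt_label (hL : IsLeafScheme L) (h : StrictPrefix s t) :
    (standardTree (List ℕ)).HybridLt (schemeSkeletons L) (label L s) (label L t) := by
  have hsup : ∀ {v}, v ∈ conePositions L →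
      label L v ∈ (standardTree (List ℕ)).support (schemeSkeletons L) := fun hv => by
    rw [support_schemeSkeletons hL]
    exact ⟨_, hv, rfl⟩
  obtain ⟨b, hb, hbs⟩ := exists_mem_graftPositions hL s
  obtain ⟨c, hc, hct⟩ := exists_mem_graftPositions hL t
  by_cases hs : s ∈ conePositions L <;> by_cases ht : t ∈ conePositions L
  · exact .base (hsup hs) (hsup ht) ((standardTree_lt_label hL hs ht).2 h)
  · refine .enter (posOrder L (graftPositions L c)) ⟨c, hc, rfl⟩ (hsup hs)
      ((label_mem_schemeGraft_implant hL hc).2 ⟨hct, ht⟩) (label L c)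
      ((schemeGraft_isLeastNode_iff hL).2 rfl) ((standardTree_le_label hL hs hc).2 ?_)
    exact (prefix_total hct.1 h.1).resolve_left fun hcs => hct.2 s hcs h hs
  · obtain ⟨r, hr, hsr, hrt, hrb⟩ := exists_next_cone hbs (.inl hs) ht h
    exact .leave (posOrder L (graftPositions L b)) ⟨b, hb, rfl⟩
      ((label_mem_schemeGraft_implant hL hb).2 ⟨hbs, hs⟩) (hsup ht) (label L r)
      ((label_mem_schemeGraft_maxNodes hL).2 ⟨hrb, hr, .prefix_trans hbs.1 hsr⟩)
      ((standardTree_le_label hL hr ht).2 hrt) ((posOrder_lt_label hL).2 ⟨hbs, hrb, hsr⟩)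
  · have hIs := (label_mem_schemeGraft_implant hL hb).2 ⟨hbs, hs⟩
    have hIt := (label_mem_schemeGraft_implant hL hc).2 ⟨hct, ht⟩
    by_cases e : b = c
    · subst e
      exact .inside _ ⟨b, hb, rfl⟩ hIs hIt ((posOrder_lt_label hL).2 ⟨hbs, hct, h⟩)
    · have hsc : StrictPrefix s c := by
        -- If `c` were an initial segment of `s`, then `s` would also lie in the graft at `c`,
        -- forcing `b = c`.
        refine (prefix_total h.1 hct.1).resolve_right fun hcs => e ?_
        refine graftPositions_base_unique hb hc hs hbs ⟨hcs, fun u hu hu' => ?_⟩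
        exact hct.2 u hu (hu'.trans h)
      obtain ⟨r, hr, hsr, hrc, hrb⟩ := exists_next_cone hbs (.inl hs) hc hsc
      exact .across _ _ ⟨b, hb, rfl⟩ ⟨c, hc, rfl⟩
        (fun h' => e (posOrder_graftPositions_injective hL h')) hIs hIt (label L c)
        ((schemeGraft_isLeastNode_iff hL).2 rfl) (label L r)
        ((label_mem_schemeGraft_maxNodes hL).2 ⟨hrb, hr, .prefix_trans hbs.1 hsr⟩)
        ((standardTree_le_label hL hr hc).2 hrc) ((posOrder_lt_label hL).2 ⟨hbs, hrb, hsr⟩)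

theorem strictPrefix_of_mem_implant (hL : IsLeafScheme L) (ht : t ∈ conePositions L)
    (h : label L s ∈ (posOrder L (graftPositions L t)).implant) : StrictPrefix t s := by
  obtain ⟨hs, hsc⟩ := (label_mem_schemeGraft_implant hL ht).1 h
  exact ⟨hs.1, by rintro rfl; exact hsc ht⟩

theorem exists_of_hybridLt (hL : IsLeafScheme L) {a b : List ℕ ⊕ List ℕ}
    (h : (standardTree (List ℕ)).HybridLt (schemeSkeletons L) a b) :
    ∃ s t, a = label L s ∧ b = label L t ∧ StrictPrefix s t := by
  cases h with
  | base hx hy h =>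
    rw [support_schemeSkeletons hL] at hx hy
    obtain ⟨s, hs, rfl⟩ := hx
    obtain ⟨t, ht, rfl⟩ := hy
    exact ⟨s, t, rfl, rfl, (standardTree_lt_label hL hs ht).1 h⟩
  | inside G hG hx hy h =>
    obtain ⟨t, ht, rfl⟩ := hG
    obtain ⟨s, -, s', -, rfl, rfl, h⟩ := h
    exact ⟨s, s', rfl, rfl, h⟩
  | enter G hG hx hy z hz h =>
    obtain ⟨t, ht, rfl⟩ := hG
    rw [support_schemeSkeletons hL] at hx
    obtain ⟨s, hs, rfl⟩ := hx
    rw [(schemeGraft_isLeastNode_iff hL).1 hz, standardTree_le_label hL hs ht] at h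
    obtain ⟨s', -, -, rfl⟩ := (mem_schemeGraft_implant hL ht).1 hy
    exact ⟨s, s', rfl, rfl, .prefix_trans h (strictPrefix_of_mem_implant hL ht hy)⟩
  | leave G hG hx hy r hr hry h =>
    obtain ⟨t, ht, rfl⟩ := hG
    rw [support_schemeSkeletons hL] at hy
    obtain ⟨s', hs', rfl⟩ := hy
    obtain ⟨r, hrt, hrc, -, rfl⟩ := (mem_schemeGraft_maxNodes hL).1 hr
    obtain ⟨s, -, r', -, rfl, e, h⟩ := h
    cases label_injective hL e
    exact ⟨s, s', rfl, rfl, h.trans_prefix ((standardTree_le_label hL hrc hs').1 hry)⟩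
  | across D E hD hE hne hx hy e he r hr hre h =>
    obtain ⟨t, ht, rfl⟩ := hD
    obtain ⟨t', ht', rfl⟩ := hE
    obtain ⟨r, hrt, hrc, -, rfl⟩ := (mem_schemeGraft_maxNodes hL).1 hr
    obtain ⟨s, -, r', -, rfl, e', h⟩ := h
    cases label_injective hL e'
    rw [(schemeGraft_isLeastNode_iff hL).1 he, standardTree_le_label hL hrc ht'] at hre
    obtain ⟨s', -, -, rfl⟩ := (mem_schemeGraft_implant hL ht').1 hy
    exact ⟨s, s', rfl, rfl,
      (h.trans_prefix hre).trans (strictPrefix_of_mem_implant hL ht' hy)⟩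

theorem hybrid_schemeSkeletons (hL : IsLeafScheme L) :
    (standardTree (List ℕ)).hybrid (schemeSkeletons L) = posOrder L univ := by
  refine NodeOrder.ext ?_ ?_
  · change (standardTree (List ℕ)).support (schemeSkeletons L) ∪ _ = label L '' univ
    rw [support_schemeSkeletons hL]
    ext a
    constructor
    · rintro (⟨s, -, rfl⟩ | h)
      · exact ⟨s, trivial, rfl⟩
      · simp only [schemeSkeletons, mem_iUnion, exists_prop, exists_mem_image] at h
        obtain ⟨t, ht, h⟩ := h
        obtain ⟨s, -, -, rfl⟩ := (mem_schemeGraft_implant hL ht).1 h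
        exact ⟨s, trivial, rfl⟩
    · rintro ⟨s, -, rfl⟩
      by_cases hs : s ∈ conePositions L
      · exact .inl ⟨s, hs, rfl⟩
      · obtain ⟨t, ht, hst⟩ := exists_mem_graftPositions hL s
        exact .inr (mem_biUnion ⟨t, ht, rfl⟩ ((label_mem_schemeGraft_implant hL ht).2 ⟨hst, hs⟩))
  · funext a b
    refine propext ⟨fun h => ?_, ?_⟩
    · obtain ⟨s, t, rfl, rfl, hst⟩ := exists_of_hybridLt hL h
      exact ⟨s, trivial, t, trivial, rfl, rfl, hst⟩
    · rintro ⟨s, -, t, -, rfl, rfl, h⟩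
      exact hybridLt_label hL h

/-- The foliage grafts at all cone positions. -/
def schemeGrafts (L : List ℕ → Set (ℕ → ℕ)) : Set (Foliage (List ℕ ⊕ List ℕ) (ℕ → ℕ)) :=
  schemeGraft L '' conePositions L

theorem skeleton_image_schemeGrafts :
    Foliage.skeleton '' schemeGrafts L = schemeSkeletons L := by
  rw [schemeGrafts, image_image]
  rfl

theorem standardFoliageTree_leaf_label (hs : s ∈ conePositions L) :
    (standardFoliageTree (List ℕ)).leaf (label L s) = L s := by
  obtain ⟨x, hx⟩ := hs
  rw [label_eq_inl hx, hx]
  rfl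

theorem schemeGraft_isFoliageGraft (hL : IsLeafScheme L) (ht : t ∈ conePositions L) :
    (standardFoliageTree (List ℕ)).IsFoliageGraft (schemeGraft L t) where
  isFoliageTree := posOrder_isTree hL
  nonincreasing := by
    rintro _ ⟨s, hs, rfl⟩ _ ⟨u, hu, rfl⟩ h p hp
    rw [mem_schemeGraft_leaf hL] at hp ⊢
    exact ⟨hs, hL.anti ((posOrder_le_label hL hs hu).1 h) hp.2.1, hp.2.2⟩
  isGraft := schemeGraft_isGraft hL ht
  root_leaf := by
    intro z hz p hp
    rw [(schemeGraft_isLeastNode_iff hL).1 hz] at hp ⊢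
    rw [standardFoliageTree_leaf_label ht]
    exact ((mem_schemeGraft_leaf hL).1 hp).2.1
  max_leaf := by
    intro m hm
    obtain ⟨s, hs, hsc, hts, rfl⟩ := (mem_schemeGraft_maxNodes hL).1 hm
    rw [schemeGraft_leaf_of_strictPrefix hL hs hts, standardFoliageTree_leaf_label hsc]

theorem schemeGrafts_isConsistent (hL : IsLeafScheme L) :
    (standardFoliageTree (List ℕ)).IsConsistent (schemeGrafts L) where
  isFoliageGraft := by
    rintro _ ⟨t, ht, rfl⟩
    exact schemeGraft_isFoliageGraft hL ht
  skeleton_injOn := by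
    rintro _ ⟨t, ht, rfl⟩ _ ⟨u, hu, rfl⟩ hne h
    exact hne (by rw [posOrder_graftPositions_injective hL h])
  skeletons := by
    rw [skeleton_image_schemeGrafts]
    exact schemeSkeletons_isConsistent hL

theorem schemeGrafts_countable : (schemeGrafts L).Countable :=
  (Set.to_countable _).image _

/-- The points that can be traced through the leaves of the scheme. -/
def traced (L : List ℕ → Set (ℕ → ℕ)) : Set (ℕ → ℕ) :=
  {p | ∀ t, p ∈ L t → ∃ i, p ∈ L (t ++ [i])}

/-- By `cover`, the leaf at a non-cone position is exhausted by its sons, so points disappear only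
at cone positions, where the grafts are rooted. -/
theorem mem_loss_schemeGrafts (hL : IsLeafScheme L) {p : ℕ → ℕ} :
    p ∈ (standardFoliageTree (List ℕ)).loss (schemeGrafts L) ↔ p ∉ traced L := by
  have hcut : p ∈ (standardFoliageTree (List ℕ)).loss (schemeGrafts L) ↔
      ∃ t ∈ conePositions L, p ∈ L t ∧ ¬ ∃ i, p ∈ L (t ++ [i]) := by
    simp only [Foliage.loss, schemeGrafts, mem_iUnion, exists_prop, exists_mem_image]
    refine exists_congr fun t => and_congr_right fun ht => ?_
    constructor
    · rintro ⟨z, hz, hp, hp'⟩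
      rw [(schemeGraft_isLeastNode_iff hL).1 hz] at hp hp'
      rw [standardFoliageTree_leaf_label ht] at hp
      exact ⟨hp, fun h => hp' ((mem_schemeGraft_leaf hL).2 ⟨self_mem_graftPositions, hp, h⟩)⟩
    · rintro ⟨hp, h⟩
      refine ⟨label L t, (schemeGraft_isLeastNode_iff hL).2 rfl, ?_, fun h' => ?_⟩
      · rwa [standardFoliageTree_leaf_label ht]
      · exact h ((mem_schemeGraft_leaf hL).1 h').2.2
  rw [hcut, traced, mem_ofPred_eq]
  push Not
  constructor
  · rintro ⟨t, -, h⟩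
    exact ⟨t, h⟩
  · rintro ⟨t, hp, h⟩
    refine ⟨t, ?_, hp, h⟩
    by_contra htc
    obtain ⟨i, hi⟩ := hL.cover t htc p hp
    exact h i hi

/-- The foliage hybrid of the standard foliage tree and the grafts of a scheme. -/
noncomputable def schemeHybrid (L : List ℕ → Set (ℕ → ℕ)) :
    Foliage (List ℕ ⊕ List ℕ) (ℕ → ℕ) :=
  (standardFoliageTree (List ℕ)).hybrid (schemeGrafts L)

theorem schemeHybrid_skeleton (hL : IsLeafScheme L) :
    (schemeHybrid L).skeleton = posOrder L univ := by
  rw [← hybrid_schemeSkeletons hL, ← skeleton_image_schemeGrafts]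
  rfl

/-- A graft is trimmed only at its root, which belongs to the support and takes its leaf from the
standard tree. So both clauses of the hybrid start from the full `L s`. -/
theorem schemeHybrid_leaf (hL : IsLeafScheme L) :
    (schemeHybrid L).leaf (label L s) = L s ∩ traced L := by
  ext p
  change ((∃ G ∈ schemeGrafts L, label L s ∈ G.skeleton.implant ∧
    p ∈ G.leaf (label L s) \ (standardFoliageTree (List ℕ)).loss (schemeGrafts L)) ∨
    (label L s ∈ (standardTree (List ℕ)).support (Foliage.skeleton '' schemeGrafts L) ∧
    p ∈ (standardFoliageTree (List ℕ)).leaf (label L s) \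
      (standardFoliageTree (List ℕ)).loss (schemeGrafts L))) ↔ _
  rw [skeleton_image_schemeGrafts, support_schemeSkeletons hL, (label_injective hL).mem_set_image]
  simp only [mem_sdiff, mem_loss_schemeGrafts hL, not_not, mem_inter_iff]
  constructor
  · rintro (⟨_, ⟨t, ht, rfl⟩, hs, hp, hpt⟩ | ⟨hs, hp, hpt⟩)
    · exact ⟨((mem_schemeGraft_leaf hL).1 hp).2.1, hpt⟩
    · rw [standardFoliageTree_leaf_label hs] at hp
      exact ⟨hp, hpt⟩
  · rintro ⟨hp, hpt⟩
    by_cases hs : s ∈ conePositions L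
    · rw [← standardFoliageTree_leaf_label hs] at hp
      exact .inr ⟨hs, hp, hpt⟩
    · obtain ⟨t, ht, hst⟩ := exists_mem_graftPositions hL s
      have hI := (label_mem_schemeGraft_implant hL ht).2 ⟨hst, hs⟩
      refine .inl ⟨_, ⟨t, ht, rfl⟩, hI, ?_, hpt⟩
      rwa [schemeGraft_leaf_of_strictPrefix hL hst (strictPrefix_of_mem_implant hL ht hI)]

end Hybrid

/-! ### Branches, the Baire property and shooting for a scheme. -/

section Branches

variable {L : List ℕ → Set (ℕ → ℕ)} {s t u v : List ℕ}

/-- Successive cone positions along `a` have properly extending sequences, so their lengths are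
unbounded. -/
theorem exists_long_cone (hL : IsLeafScheme L) (a : ℕ → ℕ) (k : ℕ) :
    ∃ n x, L (initSeg a n) = baseSet x ∧ k < x.length := by
  have next : ∀ n x, L (initSeg a n) = baseSet x →
      ∃ m y, L (initSeg a m) = baseSet y ∧ x.length < y.length := by
    intro n x hx
    obtain ⟨m, hm, y, hy⟩ := hL.frequently_cone a (n + 1)
    have hnm : StrictPrefix (initSeg a n) (initSeg a m) :=
      ⟨initSeg_prefix a (by omega), fun h => by
        have := congrArg List.length h
        simp at this
        omega⟩
    have := (standardTree_lt_label hL ⟨x, hx⟩ ⟨y, hy⟩).2 hnm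
    rw [label_eq_inl hx, label_eq_inl hy, standardTree_lt_inl] at this
    exact ⟨m, y, hy, this.length_lt⟩
  induction k with
  | zero =>
    obtain ⟨n, -, x, hx⟩ := hL.frequently_cone a 0
    obtain ⟨m, y, hy, h⟩ := next n x hx
    exact ⟨m, y, hy, by omega⟩
  | succ k ih =>
    obtain ⟨n, x, hx, hk⟩ := ih
    obtain ⟨m, y, hy, h⟩ := next n x hx
    exact ⟨m, y, hy, by omega⟩

/-- A cone of length above `k` fixes the `k`-th coordinate. The point so defined lies in every leaf
because cones recur below each leaf and the fixed coordinates agree with those cones. -/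
theorem exists_unique_point (hL : IsLeafScheme L) (a : ℕ → ℕ) :
    ∃ p, (∀ n, p ∈ L (initSeg a n)) ∧ ∀ q, (∀ n, q ∈ L (initSeg a n)) → q = p := by
  choose n x hx hlen using exists_long_cone hL a
  have huniq : ∀ m k (q : ℕ → ℕ), q ∈ L (initSeg a (max m (n k))) → q k = (x k)[k]'(hlen k) := by
    intro m k q hq
    have := hL.anti (initSeg_prefix a (le_max_right m (n k))) hq
    rw [hx] at this
    exact this k (hlen k)
  refine ⟨fun k => (x k)[k]'(hlen k), fun m => ?_, fun q hq => funext fun k => ?_⟩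
  · obtain ⟨m', hm', y, hy⟩ := hL.frequently_cone a m
    refine hL.anti (initSeg_prefix a hm') ?_
    rw [hy]
    intro i hi
    -- A point of a leaf below both cones links the `i`-th term of `y` to the coordinate fixed by `x
    -- i`.
    obtain ⟨q, hq⟩ := hL.nonempty (initSeg a (max m' (n i)))
    have hqy := hL.anti (initSeg_prefix a (le_max_left m' (n i))) hq
    rw [hy] at hqy
    rw [← hqy i hi, huniq m' i q hq]
  · exact huniq 0 k q (hq _)

theorem mem_traced_of_forall_mem (hL : IsLeafScheme L) {a p : ℕ → ℕ}
    (h : ∀ n, p ∈ L (initSeg a n)) : p ∈ traced L := by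
  intro t ht
  have e : t = initSeg a t.length := by
    rcases hL.total ht (h t.length) with h' | h'
    · exact absurd h'.length_lt (by simp)
    · exact (h'.eq_of_length (by simp)).symm
  refine ⟨a t.length, ?_⟩
  have := h (t.length + 1)
  rwa [initSeg_succ, ← e] at this

theorem inter_traced_nonempty (hL : IsLeafScheme L) (t : List ℕ) : (L t ∩ traced L).Nonempty := by
  obtain ⟨a, ha⟩ := baseSet_nonempty t
  obtain ⟨p, hp, -⟩ := exists_unique_point hL a
  refine ⟨p, ?_, mem_traced_of_forall_mem hL hp⟩
  rw [← mem_baseSet_iff.1 ha]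
  exact hp _

theorem exists_initSeg_mem_of_maximal {A : Set (List ℕ)}
    (hA : ∀ s ∈ A, ∀ t ∈ A, s <+: t ∨ t <+: s)
    (hmax : ∀ t, (∀ s ∈ A, s <+: t ∨ t <+: s) → t ∈ A) :
    ∃ a : ℕ → ℕ, ∀ n, initSeg a n ∈ A := by
  have hnil : [] ∈ A := hmax [] fun s _ => .inr List.nil_prefix
  have hson : ∀ t : A, ∃ i, (t : List ℕ) ++ [i] ∈ A := by
    rintro ⟨t, ht⟩
    by_cases h : ∃ s ∈ A, StrictPrefix t s
    · obtain ⟨s, hs, hts⟩ := h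
      obtain ⟨i, hi⟩ := hts.exists_append_singleton_prefix
      refine ⟨i, hmax _ fun u hu => ?_⟩
      rcases hA s hs u hu with h | h
      · exact .inr (hi.trans h)
      · exact List.prefix_or_prefix_of_prefix h hi
    -- If nothing in `A` lies beyond `t`, every son of `t` is comparable with all of `A`, so
    -- maximality puts it into `A`.
    · refine ⟨0, hmax _ fun u hu => .inl ?_⟩
      have : u <+: t := by
        rcases hA t ht u hu with h' | h'
        · by_contra hn
          exact h ⟨u, hu, h', by rintro rfl; exact hn h'⟩
        · exact h'
      exact this.trans (List.prefix_append _ _)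
  choose f hf using hson
  let g : ℕ → A := fun n => Nat.rec ⟨[], hnil⟩ (fun _ t => ⟨t ++ [f t], hf t⟩) n
  refine ⟨fun n => f (g n), fun n => ?_⟩
  have : initSeg (fun n => f (g n)) n = (g n).1 := by
    induction n with
    | zero => rfl
    | succ n ih => rw [initSeg_succ, ih]
  rw [this]
  exact (g n).2

theorem exists_fruit_eq_singleton (hL : IsLeafScheme L) {B : Set (List ℕ ⊕ List ℕ)}
    (hB : (posOrder L univ).IsBranch B) : ∃ p, (schemeHybrid L).fruit B = {p} := by
  have hA : ∀ s ∈ label L ⁻¹' B, ∀ t ∈ label L ⁻¹' B, s <+: t ∨ t <+: s := by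
    intro s hs t ht
    rcases hB.1.2 _ hs _ ht with h | h
    · exact .inl ((posOrder_le_label hL (mem_univ _) (mem_univ _)).1 h)
    · exact .inr ((posOrder_lt_label hL).1 h).2.2.1
  have hmax : ∀ t, (∀ s ∈ label L ⁻¹' B, s <+: t ∨ t <+: s) → t ∈ label L ⁻¹' B := by
    intro t ht
    have hcmp : ∀ v w : List ℕ, v <+: w ∨ w <+: v →
        (posOrder L univ).le (label L v) (label L w) ∨
          (posOrder L univ).lt (label L w) (label L v) := by
      intro v w h
      by_cases h' : v <+: w
      · exact .inl ((posOrder_le_label hL (mem_univ _) (mem_univ _)).2 h')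
      · refine .inr ((posOrder_lt_label hL).2 ⟨trivial, trivial, h.resolve_left h', ?_⟩)
        rintro rfl
        exact h' List.prefix_rfl
    have hchain : (posOrder L univ).IsChain (insert (label L t) B) := by
      refine ⟨insert_subset ⟨t, trivial, rfl⟩ hB.1.1, ?_⟩
      rintro v (rfl | hv) w (rfl | hw)
      · exact .inl (.inr rfl)
      · obtain ⟨s, -, rfl⟩ := hB.1.1 hw
        exact hcmp t s (ht s hw).symm
      · obtain ⟨s, -, rfl⟩ := hB.1.1 hv
        exact hcmp s t (ht s hv)
      · exact hB.1.2 v hv w hw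
    have := hB.2 _ hchain (subset_insert _ _)
    rw [mem_preimage, ← this]
    exact mem_insert _ _
  obtain ⟨a, ha⟩ := exists_initSeg_mem_of_maximal hA hmax
  obtain ⟨p, hp, huniq⟩ := exists_unique_point hL a
  refine ⟨p, Subset.antisymm ?_ ?_⟩
  · intro q hq
    refine huniq q fun n => ?_
    have := mem_iInter₂.1 hq _ (ha n)
    rw [schemeHybrid_leaf hL] at this
    exact this.1
  · rintro _ rfl
    refine mem_iInter₂.2 fun x hx => ?_
    obtain ⟨t, -, rfl⟩ := hB.1.1 hx
    rw [schemeHybrid_leaf hL]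
    refine ⟨?_, mem_traced_of_forall_mem hL hp⟩
    have e : t = initSeg a t.length := by
      rcases hA t hx _ (ha t.length) with h | h
      · exact h.eq_of_length (by simp)
      · exact (h.eq_of_length (by simp)).symm
    rw [e]
    exact hp _

theorem schemeHybrid_isBaireFoliageTreeOn (hL : IsLeafScheme L) :
    (schemeHybrid L).IsBaireFoliageTreeOn (traced L) where
  isFoliageTree := by
    rw [Foliage.IsFoliageTree, schemeHybrid_skeleton hL]
    exact posOrder_isTree hL
  isOpen := by
    rw [Foliage.IsOpenInSubspace, schemeHybrid_skeleton hL]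
    rintro _ ⟨t, -, rfl⟩
    exact ⟨L t, hL.isOpen t, schemeHybrid_leaf hL⟩
  locallyStrict := by
    rw [Foliage.LocallyStrict, schemeHybrid_skeleton hL]
    rintro _ ⟨⟨t, -, rfl⟩, -⟩
    rw [posOrder_univ_sons hL, Foliage.fleshOf, biUnion_range]
    simp only [schemeHybrid_leaf hL]
    constructor
    · ext p
      simp only [mem_inter_iff, mem_iUnion]
      constructor
      · rintro ⟨hp, hpt⟩
        obtain ⟨i, hi⟩ := hpt t hp
        exact ⟨i, hi, hpt⟩
      · rintro ⟨i, hi, hpt⟩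
        exact ⟨hL.son_subset t i hi, hpt⟩
    · rintro _ ⟨i, rfl⟩ _ ⟨j, rfl⟩ hne
      rw [Function.onFun, schemeHybrid_leaf hL, schemeHybrid_leaf hL, Set.disjoint_left]
      rintro p ⟨hi, -⟩ ⟨hj, -⟩
      exact hne (by rw [hL.sons_disjoint t i j p hi hj])
  isOmegaTree := by
    rw [schemeHybrid_skeleton hL]
    exact posOrder_univ_isOmegaTree hL
  strictBranches := by
    rw [Foliage.HasStrictBranches, schemeHybrid_skeleton hL]
    exact ⟨⟨_, [], trivial, rfl⟩, fun B hB => exists_fruit_eq_singleton hL hB⟩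
  root_leaf := by
    rw [schemeHybrid_skeleton hL]
    refine ⟨_, posOrder_univ_isLeastNode hL, ?_⟩
    rw [schemeHybrid_leaf hL, hL.nil, baseSet_nil, univ_inter]

theorem standardTree_sons {I : Type*} (y : List ℕ) :
    (standardTree I).sons (Sum.inl y) = range fun c => Sum.inl (y ++ [c]) := by
  ext a
  constructor
  · rintro ⟨⟨y', w, e, rfl, h⟩, hmin⟩
    cases e
    obtain ⟨c, hc⟩ := StrictPrefix.exists_append_singleton_prefix h
    refine ⟨c, congrArg _ ?_⟩
    by_contra hne
    exact hmin ⟨Sum.inl (y ++ [c]), standardTree_lt_inl.2 (.append_singleton y c),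
      standardTree_lt_inl.2 ⟨hc, hne⟩⟩
  · rintro ⟨c, rfl⟩
    refine ⟨standardTree_lt_inl.2 (.append_singleton y c), ?_⟩
    rintro ⟨_, ⟨y', w, e, rfl, h⟩, h'⟩
    cases e
    exact StrictPrefix.not_prefix h (strictPrefix_append_singleton_iff.1 (standardTree_lt_inl.1 h'))

/-- A cofinite set of sons of `y` omits only finitely many `y ++ [c]`. By the hypothesis each of
these spoils finitely many sons of `t`; all other leaves inside `baseSet y` are covered by the
chosen sons. -/
theorem schemeHybrid_shootsInto (hL : IsLeafScheme L)
    (h : ∀ p ∈ traced L, ∀ y, p ∈ baseSet y → ∃ t, p ∈ L t ∧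
      ∀ c, {i | ¬ L (t ++ [i]) ⊆ baseSet y \ baseSet (y ++ [c])}.Finite) :
    (schemeHybrid L).ShootsInto (standardFoliageTree (List ℕ)) := by
  rintro p hp _ ⟨⟨y, rfl⟩, hpy⟩
  have hpt : p ∈ traced L := by
    simp only [Foliage.flesh, Foliage.fleshOf, mem_iUnion, exists_prop,
      schemeHybrid_skeleton hL] at hp
    obtain ⟨_, ⟨t, -, rfl⟩, hp⟩ := hp
    rw [schemeHybrid_leaf hL] at hp
    exact hp.2
  obtain ⟨t, hpL, hfin⟩ := h p hpt y hpy
  refine ⟨label L t, ⟨?_, ?_⟩, ?_⟩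
  · rw [schemeHybrid_skeleton hL]
    exact ⟨t, trivial, rfl⟩
  · rw [schemeHybrid_leaf hL]
    exact ⟨hpL, hpt⟩
  rintro _ ⟨C, hC, hcof, rfl⟩ -
  change C ⊆ (standardTree (List ℕ)).sons (Sum.inl y) at hC
  change ((standardTree (List ℕ)).sons (Sum.inl y) \ C).Finite at hcof
  rw [standardTree_sons] at hC hcof
  have hbad : {c | Sum.inl (y ++ [c]) ∉ C}.Finite := by
    have hinj : Function.Injective fun c => (Sum.inl (y ++ [c]) : List ℕ ⊕ List ℕ) := by
      intro c c' hcc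
      simpa using hcc
    exact (hcof.preimage hinj.injOn).subset fun c hc => ⟨⟨c, rfl⟩, hc⟩
  have hbad' : {i | ¬ (L (t ++ [i]) ⊆ baseSet y) ∨
      ∃ c, Sum.inl (y ++ [c]) ∉ C ∧ ¬ L (t ++ [i]) ⊆ (baseSet (y ++ [c]))ᶜ}.Finite := by
    refine ((hfin 0).union (hbad.biUnion fun c _ => hfin c)).subset ?_
    rintro i (hi | ⟨c, hc, hi⟩)
    · exact .inl fun h' => hi (h'.trans sdiff_subset)
    · exact .inr (mem_biUnion hc fun h' => hi fun q hq => (h' hq).2)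
  have hsub : ∀ i, i ∉ {i | ¬ (L (t ++ [i]) ⊆ baseSet y) ∨
      ∃ c, Sum.inl (y ++ [c]) ∉ C ∧ ¬ L (t ++ [i]) ⊆ (baseSet (y ++ [c]))ᶜ} →
      L (t ++ [i]) ⊆ (standardFoliageTree (List ℕ)).fleshOf C := by
    intro i hi q hq
    rw [mem_ofPred_eq] at hi
    push Not at hi
    have hqc : q ∈ baseSet (y ++ [q y.length]) :=
      mem_baseSet_append_singleton.2 ⟨hi.1 hq, rfl⟩
    have : Sum.inl (y ++ [q y.length]) ∈ C := by
      by_contra hn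
      exact hi.2 _ hn hq hqc
    exact mem_biUnion this hqc
  set bad := {i | ¬ (L (t ++ [i]) ⊆ baseSet y) ∨
      ∃ c, Sum.inl (y ++ [c]) ∉ C ∧ ¬ L (t ++ [i]) ⊆ (baseSet (y ++ [c]))ᶜ}
  refine ⟨_, ⟨(fun i => label L (t ++ [i])) '' badᶜ, ?_, ?_, rfl⟩, ?_, ?_⟩
  · rw [schemeHybrid_skeleton hL, posOrder_univ_sons hL]
    exact image_subset_range _ _
  · rw [schemeHybrid_skeleton hL, posOrder_univ_sons hL]
    refine (hbad'.image fun i => label L (t ++ [i])).subset ?_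
    rintro _ ⟨⟨i, rfl⟩, hi⟩
    refine ⟨i, ?_, rfl⟩
    by_contra hn
    exact hi ⟨i, hn, rfl⟩
  · obtain ⟨i, hi⟩ := hbad'.infinite_compl.nonempty
    obtain ⟨q, hq⟩ := inter_traced_nonempty hL (t ++ [i])
    refine ⟨q, mem_biUnion ⟨i, hi, rfl⟩ ?_⟩
    rwa [schemeHybrid_leaf hL]
  · refine iUnion₂_subset ?_
    rintro _ ⟨i, hi, rfl⟩
    rw [schemeHybrid_leaf hL]
    exact inter_subset_left.trans (hsub i hi)

end Branches

/-! ### Packings: splitting a basic open set along a π-dense open set. -/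

/-- A partition of `baseSet x ∩ U` into basic open sets `baseSet (base i d ++ [digit i d k])`, where
`d ≤ len i`. For fixed `i`, every sequence between `x` and `base i d` is of the form `base i d'`
for some `d'` between `d` and `len i`. -/
structure Packing (x : List ℕ) (U : Set (ℕ → ℕ)) where
  /-- the index of the last level of a package -/
  len : ℕ → ℕ
  /-- the sequence that is extended at a level of a package -/
  base : ℕ → ℕ → List ℕ
  /-- the terms added at a level of a package -/
  digit : ℕ → ℕ → ℕ → ℕ
  prefix_base : ∀ i d, d ≤ len i → x <+: base i d
  subset : ∀ i d k, d ≤ len i → baseSet (base i d ++ [digit i d k]) ⊆ U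
  unique : ∀ i d k i' d' k' p, d ≤ len i → d' ≤ len i' →
    p ∈ baseSet (base i d ++ [digit i d k]) → p ∈ baseSet (base i' d' ++ [digit i' d' k']) →
    i = i' ∧ d = d' ∧ k = k'
  cover : ∀ p ∈ baseSet x, p ∈ U → ∃ i d k, d ≤ len i ∧ p ∈ baseSet (base i d ++ [digit i d k])
  chain : ∀ i d y, d ≤ len i → x <+: y → y <+: base i d → ∃ d', d ≤ d' ∧ d' ≤ len i ∧ base i d' = y

/-- An infinite set of natural numbers is split into infinitely many infinite sets. -/
theorem exists_digit_splitting {A I : Set ℕ} (hA : A.Infinite) (hI : I.Nonempty) :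
    ∃ f : ℕ → ℕ → ℕ, (∀ i ∈ I, ∀ k, f i k ∈ A) ∧ (∀ c ∈ A, ∃ i ∈ I, ∃ k, f i k = c) ∧
      ∀ i ∈ I, ∀ k, ∀ i' ∈ I, ∀ k', f i k = f i' k' → i = i' ∧ k = k' := by
  classical
  have : Infinite A := hA.to_subtype
  have : Nonempty I := hI.to_subtype
  obtain ⟨e⟩ := nonempty_equiv_of_countable (α := I × ℕ) (β := A)
  refine ⟨fun i k => if h : i ∈ I then e (⟨i, h⟩, k) else 0, ?_, ?_, ?_⟩
  · intro i hi k
    simp [hi]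
  · intro c hc
    obtain ⟨⟨⟨i, hi⟩, k⟩, h⟩ := e.surjective ⟨c, hc⟩
    exact ⟨i, hi, k, by simp [hi, h]⟩
  · intro i hi k i' hi' k' h
    simp only [hi, hi', dif_pos, Subtype.val_inj, e.injective.eq_iff, Prod.mk.injEq,
      Subtype.mk.injEq] at h
    exact h

theorem exists_minimal_cone {U : Set (ℕ → ℕ)} (hU : IsOpen U) {x : List ℕ} {p : ℕ → ℕ}
    (hx : p ∈ baseSet x) (hp : p ∈ U) :
    ∃ y, x <+: y ∧ (y = x ∨ ¬ baseSet y ⊆ U) ∧ p ∈ baseSet y ∧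
      baseSet (y ++ [p y.length]) ⊆ U := by
  classical
  -- The `+ 1` makes every cell a proper extension of `x`, even when `baseSet x ⊆ U`; otherwise the
  -- splitting could stall.
  have hex : ∃ m, baseSet (initSeg p (x.length + m + 1)) ⊆ U := by
    obtain ⟨n, hn⟩ := exists_baseSet_initSeg_subset hU hp
    exact ⟨n, (baseSet_subset_iff.2 (initSeg_prefix p (by omega))).trans hn⟩
  have hspec := Nat.find_spec hex
  have hmin := fun m => Nat.find_min (m := m) hex
  generalize Nat.find hex = m at hspec hmin
  refine ⟨initSeg p (x.length + m), ?_, ?_, mem_baseSet_initSeg _ _, ?_⟩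
  · conv_lhs => rw [← mem_baseSet_iff.1 hx]
    exact initSeg_prefix p (by omega)
  · cases m with
    | zero => exact .inl (mem_baseSet_iff.1 hx)
    | succ m => exact .inr (hmin m (by omega))
  · rw [length_initSeg, ← initSeg_succ]
    exact hspec

/-- If `y'` extended `y ++ [c]`, its cone would lie in `U`, leaving only `y' = x`, an initial
segment of `y`. Used in both directions, this identifies the bases of two overlapping cells. -/
theorem minimal_cone_unique {U : Set (ℕ → ℕ)} {x y y' : List ℕ} {c c' : ℕ} {p : ℕ → ℕ}
    (hxy : x <+: y) (hy' : y' = x ∨ ¬ baseSet y' ⊆ U) (hc : baseSet (y ++ [c]) ⊆ U)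
    (hp : p ∈ baseSet (y ++ [c])) (hp' : p ∈ baseSet (y' ++ [c'])) : y' <+: y := by
  have hpy' := (mem_baseSet_append_singleton.1 hp').1
  rcases prefix_total_of_mem_baseSet hpy' hp with h | h
  · exact strictPrefix_append_singleton_iff.1 h
  · rcases hy' with rfl | hy'
    · exact hxy
    · exact absurd ((baseSet_subset_iff.2 h).trans hc) hy'

theorem nonempty_packing {U : Set (ℕ → ℕ)} (hU : IsOpen U) (hd : IsPiDense U) (x : List ℕ) :
    Nonempty (Packing x U) := by
  let T : Set (List ℕ) := {y | x <+: y ∧ (y = x ∨ ¬ baseSet y ⊆ U)}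
  have hTclosed : ∀ y y', y ∈ T → x <+: y' → y' <+: y → y' ∈ T := by
    rintro y y' ⟨-, hy⟩ hxy' hy'
    refine ⟨hxy', ?_⟩
    rcases hy with rfl | hy
    · exact .inl (hy'.eq_of_length_le hxy'.length_le)
    · exact .inr fun h => hy ((baseSet_subset_iff.2 hy').trans h)
  have hTunique : ∀ y ∈ T, ∀ y' ∈ T, ∀ c c' p, baseSet (y ++ [c]) ⊆ U →
      baseSet (y' ++ [c']) ⊆ U → p ∈ baseSet (y ++ [c]) → p ∈ baseSet (y' ++ [c']) → y = y' :=
    fun y hy y' hy' c c' p hc hc' hp hp' =>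
      (minimal_cone_unique hy'.1 hy.2 hc' hp' hp).eq_of_length_le
        (minimal_cone_unique hy.1 hy'.2 hc hp hp').length_le
  have : Nonempty T := ⟨x, List.prefix_rfl, .inl rfl⟩
  -- `T` may be finite, so `z` may repeat. The digits at `y` are split among indices, not among
  -- values of `z`, which keeps the packages disjoint and infinite in number.
  obtain ⟨z, hz⟩ := exists_surjective_nat T
  have hsplit : ∀ y : List ℕ, ∃ f : ℕ → ℕ → ℕ, y ∈ T →
      (∀ i, y <+: z i → ∀ k, baseSet (y ++ [f i k]) ⊆ U) ∧
      (∀ c, baseSet (y ++ [c]) ⊆ U → ∃ i, y <+: z i ∧ ∃ k, f i k = c) ∧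
      ∀ i, y <+: z i → ∀ k i', y <+: z i' → ∀ k', f i k = f i' k' → i = i' ∧ k = k' := by
    intro y
    by_cases hy : y ∈ T
    · obtain ⟨i, hi⟩ := hz ⟨y, hy⟩
      have hne : {i | y <+: (z i : List ℕ)}.Nonempty := ⟨i, by
        rw [mem_ofPred_eq, hi]⟩
      obtain ⟨f, h1, h2, h3⟩ := exists_digit_splitting (hd y) hne
      exact ⟨f, fun _ => ⟨h1, h2, h3⟩⟩
    · exact ⟨fun _ _ => 0, fun h => absurd h hy⟩
  choose f hf using hsplit
  -- Levels count from the top: level `0` is `z i` and the last level is `x`. Thus the levels up to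
  -- `d` are those at or beyond `base i d`.
  let base : ℕ → ℕ → List ℕ := fun i d => (z i : List ℕ).take ((z i : List ℕ).length - d)
  have hlen : ∀ i, x.length ≤ (z i : List ℕ).length := fun i => (z i).2.1.length_le
  have hbz : ∀ i d, base i d <+: z i := fun i d => List.take_prefix _ _
  have hxb : ∀ i d, d ≤ (z i : List ℕ).length - x.length → x <+: base i d := by
    intro i d h
    have := hlen i
    exact List.prefix_take_iff.2 ⟨(z i).2.1, by omega⟩
  have hbT : ∀ i d, d ≤ (z i : List ℕ).length - x.length → base i d ∈ T := fun i d h =>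
    hTclosed _ _ (z i).2 (hxb i d h) (hbz i d)
  have hblen : ∀ i d, (base i d).length = (z i : List ℕ).length - d := by simp [base]
  have hbase : ∀ i y, y <+: (z i : List ℕ) → base i ((z i : List ℕ).length - y.length) = y := by
    intro i y hy
    have := hy.length_le
    simp only [base]
    rw [Nat.sub_sub_self this]
    exact (List.prefix_iff_eq_take.1 hy).symm
  exact ⟨{
    len := fun i => (z i : List ℕ).length - x.length
    base := base
    digit := fun i d k => f (base i d) i k
    prefix_base := hxb
    subset := fun i d k h => (hf _ (hbT i d h)).1 i (hbz i d) k
    unique := by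
      intro i d k i' d' k' p h h' hp hp'
      have hU1 := (hf _ (hbT i d h)).1 i (hbz i d) k
      have hU2 := (hf _ (hbT i' d' h')).1 i' (hbz i' d') k'
      have e := hTunique _ (hbT i d h) _ (hbT i' d' h') _ _ p hU1 hU2 hp hp'
      have e' : f (base i d) i k = f (base i d) i' k' := by
        have h1 := (mem_baseSet_append_singleton.1 hp).2
        have h2 := (mem_baseSet_append_singleton.1 hp').2
        rw [← e] at h2
        exact h1.symm.trans h2
      obtain ⟨rfl, rfl⟩ := (hf _ (hbT i d h)).2.2 i (hbz i d) k i' (e ▸ hbz i' d') k' e'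
      refine ⟨rfl, ?_, rfl⟩
      have := congrArg List.length e
      rw [hblen, hblen] at this
      have := hlen i
      omega
    cover := by
      intro p hpx hpU
      obtain ⟨y, hxy, hy, hpy, hsub⟩ := exists_minimal_cone hU hpx hpU
      obtain ⟨i, hyi, k, hk⟩ := (hf y ⟨hxy, hy⟩).2.1 _ hsub
      have := hxy.length_le
      refine ⟨i, (z i : List ℕ).length - y.length, k, by omega, ?_⟩
      rw [hbase i y hyi, hk]
      exact mem_baseSet_append_singleton.2 ⟨hpy, rfl⟩
    chain := by
      intro i d y h hxy hy
      have h1 := hxy.length_le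
      have h2 := hy.length_le
      rw [hblen] at h2
      have h3 := hlen i
      exact ⟨(z i : List ℕ).length - y.length, by omega, by omega,
        hbase i y (hy.trans (hbz i d))⟩ }⟩

/-- The basic open sets of a packing are given by these finite sequences. -/
def Packing.cell {x : List ℕ} {U : Set (ℕ → ℕ)} (P : Packing x U) (i d k : ℕ) : List ℕ :=
  P.base i d ++ [P.digit i d k]

/-! ### The scheme produced by iterated packings. -/

/-- What a position of the scheme stands for: a basic open set that is about to be split by the
`n`-th packing, or the levels up to `d` of the `i`-th package in such a splitting. -/
inductive SplitState
  | root (n : ℕ) (x : List ℕ)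
  | pack (n : ℕ) (x : List ℕ) (i d : ℕ)

namespace SplitState

variable {U : ℕ → Set (ℕ → ℕ)} (P : ∀ n x, Packing x (U n))

/-- The leaf of a state. -/
def leaf : SplitState → Set (ℕ → ℕ)
  | root _ x => baseSet x
  | pack n x i d => {p | ∃ d' ≤ d, ∃ k, p ∈ baseSet ((P n x).cell i d' k)}

/-- The sons of a state. -/
def step : SplitState → ℕ → SplitState
  | root n x, i => pack n x i ((P n x).len i)
  | pack n x i 0, k => root (n + 1) ((P n x).cell i 0 k)
  -- Son `0` carries the remaining levels, so the cells of level `d + 1` are shifted by one. At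
  -- level `0` nothing remains and there is no shift.
  | pack n x i (d + 1), 0 => pack n x i d
  | pack n x i (d + 1), k + 1 => root (n + 1) ((P n x).cell i (d + 1) k)

/-- The level of a state is a level of its package. -/
def Valid : SplitState → Prop
  | root _ _ => True
  | pack n x i d => d ≤ (P n x).len i

/-- The state at a position. -/
def stateAt (t : List ℕ) : SplitState := t.foldl (step P) (root 0 [])

/-- The leaf at a position. -/
def leafAt (t : List ℕ) : Set (ℕ → ℕ) := leaf P (stateAt P t)

theorem stateAt_append_singleton (t : List ℕ) (i : ℕ) :
    stateAt P (t ++ [i]) = step P (stateAt P t) i := by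
  simp [stateAt]

variable {P}

theorem Valid.step {s : SplitState} (h : Valid P s) (i : ℕ) : Valid P (step P s i) := by
  match s, i with
  | root n x, i => exact le_rfl
  | pack n x i 0, k => trivial
  | pack n x i (d + 1), 0 => exact Nat.le_of_succ_le h
  | pack n x i (d + 1), k + 1 => trivial

variable (P) in
theorem valid_stateAt (t : List ℕ) : Valid P (stateAt P t) := by
  induction t using List.reverseRecOn with
  | nil => trivial
  | append_singleton t i ih =>
    rw [stateAt_append_singleton]
    exact ih.step i

theorem leaf_step_subset {s : SplitState} (h : Valid P s) (i : ℕ) :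
    leaf P (step P s i) ⊆ leaf P s := by
  match s, i with
  | root n x, i =>
    rintro p ⟨d, hd, k, hp⟩
    refine baseSet_subset_iff.2 ?_ hp
    exact ((P n x).prefix_base i d hd).trans (List.prefix_append _ _)
  | pack n x i 0, k => exact fun p hp => ⟨0, le_rfl, k, hp⟩
  | pack n x i (d + 1), 0 => exact fun p ⟨d', hd, h⟩ => ⟨d', by omega, h⟩
  | pack n x i (d + 1), k + 1 => exact fun p hp => ⟨d + 1, le_rfl, k, hp⟩

theorem leaf_step_unique {s : SplitState} (h : Valid P s) {i j : ℕ} {p : ℕ → ℕ}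
    (hi : p ∈ leaf P (step P s i)) (hj : p ∈ leaf P (step P s j)) : i = j := by
  match s, i, j with
  | root n x, i, j =>
    obtain ⟨d, hd, k, hp⟩ := hi
    obtain ⟨d', hd', k', hp'⟩ := hj
    exact ((P n x).unique _ _ _ _ _ _ p hd hd' hp hp').1
  | pack n x i 0, k, k' => exact ((P n x).unique _ _ _ _ _ _ p h h hi hj).2.2
  | pack n x i (d + 1), 0, 0 => rfl
  | pack n x i (d + 1), 0, k + 1 =>
    obtain ⟨d', hd', k', hp'⟩ := hi
    have h' : d + 1 ≤ (P n x).len i := h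
    have := ((P n x).unique _ _ _ _ _ _ p (by omega) h hp' hj).2.1
    omega
  | pack n x i (d + 1), k + 1, 0 =>
    obtain ⟨d', hd', k', hp'⟩ := hj
    have h' : d + 1 ≤ (P n x).len i := h
    have := ((P n x).unique _ _ _ _ _ _ p (by omega) h hp' hi).2.1
    omega
  | pack n x i (d + 1), k + 1, k' + 1 =>
    rw [((P n x).unique _ _ _ _ _ _ p h h hi hj).2.2]

theorem exists_step_eq_root (n : ℕ) (x : List ℕ) (i d k : ℕ) :
    ∃ j, step P (pack n x i d) j = root (n + 1) ((P n x).cell i d k) := by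
  cases d with
  | zero => exact ⟨k, rfl⟩
  | succ d => exact ⟨k + 1, rfl⟩

theorem exists_mem_step_pack {n : ℕ} {x : List ℕ} {i d : ℕ} {p : ℕ → ℕ}
    (hp : p ∈ leaf P (pack n x i d)) : ∃ j, p ∈ leaf P (step P (pack n x i d) j) := by
  obtain ⟨d', hd, k, hp⟩ := hp
  rcases hd.eq_or_lt with rfl | hlt
  · obtain ⟨j, hj⟩ := exists_step_eq_root (P := P) n x i d' k
    exact ⟨j, by rw [hj]; exact hp⟩
  · obtain ⟨d, rfl⟩ := Nat.exists_eq_add_of_lt hlt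
    exact ⟨0, d', by omega, k, hp⟩

theorem exists_mem_step_root_iff {n : ℕ} {x : List ℕ} {p : ℕ → ℕ} (hp : p ∈ baseSet x) :
    (∃ j, p ∈ leaf P (step P (root n x) j)) ↔ p ∈ U n := by
  constructor
  · rintro ⟨j, d, hd, k, hp⟩
    exact (P n x).subset j d k hd hp
  · intro hU
    obtain ⟨i, d, k, hd, h⟩ := (P n x).cover p hp hU
    exact ⟨i, d, hd, k, h⟩

theorem leaf_nonempty (s : SplitState) : (leaf P s).Nonempty := by
  cases s with
  | root n x => exact baseSet_nonempty x
  | pack n x i d =>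
    obtain ⟨p, hp⟩ := baseSet_nonempty ((P n x).cell i 0 0)
    exact ⟨p, 0, Nat.zero_le _, 0, hp⟩

theorem isOpen_leaf (s : SplitState) : IsOpen (leaf P s) := by
  cases s with
  | root n x => exact isOpen_baseSet x
  | pack n x i d =>
    have : leaf P (pack n x i d) = ⋃ d' ≤ d, ⋃ k, baseSet ((P n x).cell i d' k) := by
      ext p
      simp [leaf]
    rw [this]
    exact isOpen_biUnion fun _ _ => isOpen_iUnion fun _ => isOpen_baseSet _

/-- Each passage to son `0` lowers `d`, and every other son is a cell, so a package is left after
finitely many steps. -/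
theorem exists_root_of_pack (a : ℕ → ℕ) {n : ℕ} {x : List ℕ} {i d N : ℕ}
    (h : stateAt P (initSeg a N) = pack n x i d) :
    ∃ M ≥ N, ∃ y, stateAt P (initSeg a M) = root (n + 1) y := by
  have hstep := stateAt_append_singleton P (initSeg a N) (a N)
  rw [← initSeg_succ, h] at hstep
  induction d generalizing N with
  | zero => exact ⟨N + 1, by omega, _, hstep⟩
  | succ d ih =>
    generalize hk : a N = k at hstep
    cases k with
    | zero =>
      have hstep' := stateAt_append_singleton P (initSeg a (N + 1)) (a (N + 1))
      rw [← initSeg_succ, hstep] at hstep'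
      obtain ⟨M, hM, h'⟩ := ih hstep hstep'
      exact ⟨M, by omega, h'⟩
    | succ k => exact ⟨N + 1, by omega, _, hstep⟩

variable (P) in
theorem isLeafScheme_leafAt : IsLeafScheme (leafAt P) where
  nil := rfl
  nonempty t := leaf_nonempty _
  isOpen t := isOpen_leaf _
  son_subset t i := by
    rw [leafAt, stateAt_append_singleton]
    exact leaf_step_subset (valid_stateAt P t) i
  sons_disjoint t i j p hi hj := by
    rw [leafAt, stateAt_append_singleton] at hi hj
    exact leaf_step_unique (valid_stateAt P t) hi hj
  cover t ht p hp := by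
    simp only [leafAt, stateAt_append_singleton] at hp ⊢
    cases h : stateAt P t with
    -- Only that every `root` is a cone position is needed; a `pack` whose leaf happens to be a
    -- basic open set does no harm.
    | root n x => exact absurd ⟨x, by rw [leafAt, h]; rfl⟩ ht
    | pack n x i d =>
      rw [h] at hp
      exact exists_mem_step_pack hp
  frequently_cone a N := by
    cases h : stateAt P (initSeg a N) with
    | root n x => exact ⟨N, le_rfl, x, by rw [leafAt, h]; rfl⟩
    | pack n x i d =>
      obtain ⟨M, hM, y, hy⟩ := exists_root_of_pack a h
      exact ⟨M, hM, y, by rw [leafAt, hy]; rfl⟩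

theorem exists_root_of_mem_pack {n : ℕ} {x : List ℕ} {i d : ℕ} {t : List ℕ} {p : ℕ → ℕ}
    (h : stateAt P t = pack n x i d) (hp : p ∈ leafAt P t) :
    ∃ u y, stateAt P u = root (n + 1) y ∧ p ∈ leafAt P u := by
  have hmem : ∃ j, p ∈ leafAt P (t ++ [j]) := by
    simp only [leafAt, stateAt_append_singleton, h] at hp ⊢
    exact exists_mem_step_pack hp
  obtain ⟨j, hj⟩ := hmem
  have hstep := stateAt_append_singleton P t j
  rw [h] at hstep
  induction d generalizing t j with
  | zero => exact ⟨_, _, hstep, hj⟩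
  | succ d ih =>
    cases j with
    | zero =>
      obtain ⟨k, hk⟩ : ∃ k, p ∈ leafAt P ((t ++ [0]) ++ [k]) := by
        rw [leafAt, hstep] at hj
        simp only [leafAt, stateAt_append_singleton P (t ++ [0]), hstep]
        exact exists_mem_step_pack hj
      exact ih hstep hj k hk (by rw [stateAt_append_singleton P (t ++ [0]), hstep]; rfl)
    | succ k => exact ⟨_, _, hstep, hj⟩

variable (P) in
-- A `pack` state loses no points and a `root` of level `n` loses exactly the points outside `U n`.
-- A traced point meets a `root` of every level.
theorem traced_leafAt : traced (leafAt P) = ⋂ n, U n := by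
  ext p
  rw [mem_iInter]
  constructor
  · intro hp n
    have hroot : ∃ t x, stateAt P t = root n x ∧ p ∈ leafAt P t := by
      induction n with
      | zero => exact ⟨[], [], rfl, by simp [leafAt, stateAt, leaf, baseSet_nil]⟩
      | succ n ih =>
        obtain ⟨t, x, ht, hpt⟩ := ih
        obtain ⟨i, hi⟩ := hp t hpt
        have hstep := stateAt_append_singleton P t i
        rw [ht] at hstep
        exact exists_root_of_mem_pack hstep hi
    obtain ⟨t, x, ht, hpt⟩ := hroot
    obtain ⟨i, hi⟩ := hp t hpt
    rw [leafAt, stateAt_append_singleton, ht] at hi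
    rw [leafAt, ht] at hpt
    exact (exists_mem_step_root_iff hpt).1 ⟨i, hi⟩
  · intro hp t hpt
    simp only [leafAt, stateAt_append_singleton] at hpt ⊢
    cases h : stateAt P t with
    | root n x =>
      rw [h] at hpt
      exact (exists_mem_step_root_iff hpt).2 (hp n)
    | pack n x i d =>
      rw [h] at hpt
      exact exists_mem_step_pack hpt

theorem exists_stateAt_eq_pack {n : ℕ} {x : List ℕ} {t : List ℕ} (h : stateAt P t = root n x)
    {i d : ℕ} (hd : d ≤ (P n x).len i) : ∃ u, stateAt P u = pack n x i d := by
  obtain ⟨e, he⟩ := Nat.exists_eq_add_of_le hd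
  induction e generalizing d with
  | zero => exact ⟨t ++ [i], by rw [stateAt_append_singleton, h, step, he]; rfl⟩
  | succ e ih =>
    obtain ⟨u, hu⟩ := ih (d := d + 1) (by omega) (by omega)
    exact ⟨u ++ [0], by rw [stateAt_append_singleton, hu]; rfl⟩

theorem baseSet_cell_subset {n : ℕ} {x : List ℕ} {i d k c : ℕ} (h : (P n x).digit i d k ≠ c) :
    baseSet ((P n x).cell i d k) ⊆
      baseSet ((P n x).base i d) \ baseSet ((P n x).base i d ++ [c]) := by
  intro p hp
  rw [Packing.cell, mem_baseSet_append_singleton] at hp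
  refine ⟨hp.1, fun hc => h ?_⟩
  rw [← hp.2, ← (mem_baseSet_append_singleton.1 hc).2]

/-- Distinct `k` give distinct digits, so at most two sons fail: the one with digit `c` and, unless
`d = 0`, son `0` with the remaining levels. -/
theorem finite_not_subset {n : ℕ} {x : List ℕ} {i d : ℕ} (hd : d ≤ (P n x).len i) (c : ℕ) :
    {j | ¬ leaf P (step P (pack n x i d) j) ⊆
      baseSet ((P n x).base i d) \ baseSet ((P n x).base i d ++ [c])}.Finite := by
  have hinj : Function.Injective ((P n x).digit i d) := by
    intro k k' h
    obtain ⟨p, hp⟩ := baseSet_nonempty ((P n x).base i d ++ [(P n x).digit i d k])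
    exact ((P n x).unique _ _ _ _ _ _ p hd hd hp (h ▸ hp)).2.2
  have hfin : {k | (P n x).digit i d k = c}.Finite := (finite_singleton c).preimage hinj.injOn
  cases d with
  | zero =>
    refine hfin.subset fun k hk => ?_
    by_contra hne
    exact hk (baseSet_cell_subset hne)
  | succ d =>
    refine ((finite_singleton 0).union (hfin.image (· + 1))).subset fun j hj => ?_
    cases j with
    | zero => exact .inl rfl
    | succ k =>
      refine .inr ⟨k, ?_, rfl⟩
      by_contra hne
      exact hj (baseSet_cell_subset hne)

theorem exists_shooting_position {p : ℕ → ℕ} (hp : ∀ n, p ∈ U n) {y : List ℕ}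
    (hy : p ∈ baseSet y) {n : ℕ} {x t : List ℕ} (ht : stateAt P t = root n x)
    (hpx : p ∈ baseSet x) (hxy : x <+: y) :
    ∃ u, p ∈ leafAt P u ∧
      ∀ c, {i | ¬ leafAt P (u ++ [i]) ⊆ baseSet y \ baseSet (y ++ [c])}.Finite := by
  induction hm : y.length - x.length using Nat.strong_induction_on generalizing n x t with
  | _ m ih =>
    obtain ⟨i, d, k, hd, hpc⟩ := (P n x).cover p hpx (hp n)
    -- If the cell of `p` properly extends `y`, then `y` is a level `d' ≥ d` of its package, and the
    -- state peeling `d'` still contains `p`. Otherwise restart from that cell, which is longer than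
    -- `x` and still an initial segment of `y`.
    rcases prefix_total_of_mem_baseSet hy hpc with h | h
    · obtain ⟨d', hdd', hd', rfl⟩ := (P n x).chain i d y hd hxy
        (strictPrefix_append_singleton_iff.1 h)
      obtain ⟨u, hu⟩ := exists_stateAt_eq_pack ht hd'
      refine ⟨u, ?_, fun c => ?_⟩
      · rw [leafAt, hu]
        exact ⟨d, hdd', k, hpc⟩
      · simp only [leafAt, stateAt_append_singleton, hu]
        exact finite_not_subset hd' c
    · obtain ⟨u, hu⟩ := exists_stateAt_eq_pack ht hd
      obtain ⟨j, hj⟩ := exists_step_eq_root (P := P) n x i d k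
      rw [← hu, ← stateAt_append_singleton] at hj
      refine ih _ ?_ hj hpc h rfl
      have h1 := h.length_le
      have h2 := ((P n x).prefix_base i d hd).length_le
      simp only [Packing.cell, List.length_append, List.length_singleton] at h1 ⊢
      omega

end SplitState

theorem mainTheorem3 (U : ℕ → Set (ℕ → ℕ)) (hopen : ∀ n, IsOpen (U n))
    (hdense : ∀ n, IsPiDense (U n)) (Y : Set (ℕ → ℕ)) (hY : Y = ⋂ n, U n) :
    ∃ (I : Type) (H : Foliage (List ℕ ⊕ I) (ℕ → ℕ)),
      H.IsBaireFoliageTreeOn Y ∧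
      H.ShootsInto (standardFoliageTree I) ∧
      ∃ φ : Set (Foliage (List ℕ ⊕ I) (ℕ → ℕ)),
        φ.Countable ∧
        (standardFoliageTree I).IsConsistent φ ∧
        H = (standardFoliageTree I).hybrid φ := by
  let P : ∀ n x, Packing x (U n) := fun n x => (nonempty_packing (hopen n) (hdense n) x).some
  have hL := SplitState.isLeafScheme_leafAt P
  have hT := SplitState.traced_leafAt P
  refine ⟨List ℕ, schemeHybrid (SplitState.leafAt P), ?_, ?_, schemeGrafts (SplitState.leafAt P),
    schemeGrafts_countable, schemeGrafts_isConsistent hL, rfl⟩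
  · rw [hY, ← hT]
    exact schemeHybrid_isBaireFoliageTreeOn hL
  · refine schemeHybrid_shootsInto hL fun p hp y hy => ?_
    rw [hT, mem_iInter] at hp
    exact SplitState.exists_shooting_position (t := []) hp hy rfl
      (by simp [baseSet_nil]) List.nil_prefix
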